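/- Let $k\in\mathbb C$ with $\Re(k)>0$, let $\vartheta$ be a root of unity, and let $\phi:\mathbb C\to\mathbb R$ be a non-zero $\mathbb R$-linear form. Let $h:\mathbb R\setminus\{0\}\to\mathbb C$ and let $f:\mathbb Q\to\mathbb C$ satisfy $$f(x+1)=\vartheta f(x)\quad (x\in\mathbb Q\setminus[-1,0]),\qquad h(x)=f(x)-\vartheta^{\pm3}|x|^{-k}f(-1/x)\quad(\pm x\in\mathbb Q_{>0}).$$ Write $\mathrm e(\alpha)=e^{2\pi i\alpha}$. For $x\in[0,1]\setminus\mathbb Q$ with continued fraction expansion $x=[0;b_1,b_2,\dots]$ let $x_r=[0;b_1,\dots,b_r]=a_r/q_r$ (in lowest terms) and $\overline{x_r}=\overline{a_r}/q_r$, where $\overline{a_r}\in(0,q_r]$ and $a_r\overline{a_r}\equiv1\bmod q_r$, and put $$f^\dagger(x)=\lim_{j\to\infty}\vartheta^{-\sigma_{2j+1}(x)}\,q_{2j+1}^{-k}\,f(\overline{x_{2j+1}}),\qquad \sigma_r(x)=3+\sum_{i=1}^{r}(-1)^ib_i .$$ Assume that one of the following two conditions holds. (1*) The function $h$ extends to a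 continuous function on $[-1,1]$ (still denoted $h$), and either $\Im k=0$ and there exist $p\in\mathbb Z$, $\alpha\in(-1,1)$ with $\phi(\vartheta^ph(\alpha))\neq0$; or $\Im k\neq0$ and there exists $\alpha\in(-1,1)$ with $h(\alpha)\ne0$. (2*) For one choice of the sign $\pm$ (the same throughout), $\lim_{x\to0^\pm}|h(x)|=\infty$; there is $\delta\in(0,1)$ such that $h(x)=O(e^{|x|^{-1+\delta}})$ for $0<|x|\le1$; and either $\Im k=0$ and there exists $p\in\mathbb Z$ such that for all sufficiently small $\varepsilon>0$ $$\liminf_{x\to0^\pm}\ \inf\Big\{\Big|\phi\Big(\vartheta^p\,\frac{h(x)-u^kh(ux)}{|h(x)|}\Big)\Big| : u>0,\ |\log u|\in(\varepsilon,\varepsilon^{2/3})\Big\}>0;$$ or $\Im k\neq0$ and there exists $\beta\in\mathbb R$ such that for all sufficiently small $\varepsilon>0$ $$\liminf_{x\to0^\pm}\ \inf\Big\{\Big|\phi\Big(\mathrm e(\alpha)\,\frac{h(x)-u^kh(ux)}{|h(x)|}\Big)\Big| : u>0,\ |\log u|\in(\varepsilon,\varepsilon^{2/3}),\ \alpha\in\mathbb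 R,\ |\alpha-\beta|<\varepsilon^{2/3}\Big\}>0.$$ Then the limit defining $f^\dagger(x)$ exists for Lebesgue-almost every $x\in[0,1]$, $f^\dagger$ is Lebesgue measurable on $[0,1]$, and the cumulative distribution function of the push-forward $(\phi\circ f^\dagger)_*(\mathrm d\nu)$ of the Lebesgue measure $\nu$ on $[0,1]$ is continuous. -/

import Mathlib

open MeasureTheory ProbabilityTheory Filter Topology

noncomputable section

namespace QMF

/-- The partial quotients `a₀(x), a₁(x), a₂(x), …` of the continued fraction expansion of `x`.
The recursion is the one of Mathlib's `Real.convergent`, whose values are the convergents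
`[a₀(x); a₁(x), …, aₙ(x)]`. -/
def partialQuotient : ℝ → ℕ → ℤ
  | x, 0 => ⌊x⌋
  | x, n + 1 => partialQuotient (Int.fract x)⁻¹ n

/-- For `y = a/q` in lowest terms, the rational `ā/q`, where `ā` is the element of `(0, q]`
with `a ā ≡ 1 mod q`. -/
def modInv (y : ℚ) : ℚ :=
  if y.den = 1 then 1 else (((y.num : ZMod y.den)⁻¹).val : ℚ) / y.den

/-- The exponent `3 + ∑_{i=1}^{r} (-1)^i b_i(x)`, used for odd `r`. -/
def twistExponent (x : ℝ) (r : ℕ) : ℤ :=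
  3 + ∑ i ∈ Finset.Icc 1 r, (-1) ^ i * partialQuotient x i

/-- With `r = 2j+1` and `x_r` the `r`-th convergent of `x`, of denominator `q`, the number
`ϑ^{-(3 + ∑_{i ≤ r} (-1)^i b_i(x))} q^{-k} f(x̄_r)`. -/
def daggerApprox (k ϑ : ℂ) (f : ℚ → ℂ) (x : ℝ) (j : ℕ) : ℂ :=
  ϑ ^ (-twistExponent x (2 * j + 1)) *
    ((x.convergent (2 * j + 1)).den : ℂ) ^ (-k) * f (modInv (x.convergent (2 * j + 1)))

/-- The limit function `f†`, the limit along the convergents of odd index. -/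
def fDagger (k ϑ : ℂ) (f : ℚ → ℂ) (x : ℝ) : ℂ :=
  limUnder atTop (daggerApprox k ϑ f x)

/-- The `ϑ`-twisted quantum modularity relations of weight `k` with period function `h`;
the periodicity is required separately on the negative and on the positive rationals.
(The value of `h` at `0` plays no role.) -/
structure IsTwistedQMF (k ϑ : ℂ) (f : ℚ → ℂ) (h : ℝ → ℂ) : Prop where
  period : ∀ x : ℚ, x ∉ Set.Icc (-1 : ℚ) 0 → f (x + 1) = ϑ * f x
  recip_pos : ∀ x : ℚ, 0 < x →
    h (x : ℝ) = f x - ϑ ^ (3 : ℤ) * (((|x| : ℚ) : ℂ) ^ (-k)) * f (-1 / x)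
  recip_neg : ∀ x : ℚ, x < 0 →
    h (x : ℝ) = f x - ϑ ^ (-3 : ℤ) * (((|x| : ℚ) : ℂ) ^ (-k)) * f (-1 / x)

/-- `h` extends to a continuous function `H` on `[-1, 1]`, with a non-vanishing condition. -/
def BoundedCondition (k ϑ : ℂ) (φ : ℂ →ₗ[ℝ] ℝ) (h : ℝ → ℂ) : Prop :=
  ∃ H : ℝ → ℂ, ContinuousOn H (Set.Icc (-1) 1) ∧
    (∀ x ∈ Set.Icc (-1 : ℝ) 1, x ≠ 0 → H x = h x) ∧
    ((k.im = 0 ∧ ∃ p : ℤ, ∃ α ∈ Set.Ioo (-1 : ℝ) 1, φ (ϑ ^ p * H α) ≠ 0) ∨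
     (k.im ≠ 0 ∧ ∃ α ∈ Set.Ioo (-1 : ℝ) 1, H α ≠ 0))

/-- The quotient `(h(x) - u^k h(u x)) / |h(x)|`. -/
def relDiff (k : ℂ) (h : ℝ → ℂ) (u x : ℝ) : ℂ :=
  (h x - (u : ℂ) ^ k * h (u * x)) / ((‖h x‖ : ℝ) : ℂ)

/-- The set of `u > 0` with `ε < |log u| < ε^{2/3}`. -/
def logShell (ε : ℝ) : Set ℝ :=
  {u : ℝ | 0 < u ∧ |Real.log u| ∈ Set.Ioo ε (ε ^ (2 / 3 : ℝ))}

/-- `h` is unbounded at `0` along `l` (which will be `𝓝[>] 0` or `𝓝[<] 0`), of subexponential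
growth, with the liminf conditions. The infima and the liminf are taken in `[0, ∞]`. -/
def UnboundedCondition (k ϑ : ℂ) (φ : ℂ →ₗ[ℝ] ℝ) (h : ℝ → ℂ) (l : Filter ℝ) : Prop :=
  Tendsto (fun x => ‖h x‖) l atTop ∧
  (∃ δ ∈ Set.Ioo (0 : ℝ) 1, ∃ C : ℝ, ∀ x : ℝ, x ≠ 0 → |x| ≤ 1 →
    ‖h x‖ ≤ C * Real.exp (|x| ^ (-1 + δ))) ∧
  ((k.im = 0 ∧ ∃ p : ℤ, ∀ᶠ ε in 𝓝[>] (0 : ℝ),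
      0 < liminf (fun x => ⨅ u ∈ logShell ε,
        ENNReal.ofReal |φ (ϑ ^ p * relDiff k h u x)|) l) ∨
   (k.im ≠ 0 ∧ ∃ β : ℝ, ∀ᶠ ε in 𝓝[>] (0 : ℝ),
      0 < liminf (fun x => ⨅ u ∈ logShell ε,
        ⨅ α ∈ {α : ℝ | |α - β| < ε ^ (2 / 3 : ℝ)},
          ENNReal.ofReal |φ (Complex.exp (2 * Real.pi * Complex.I * α) * relDiff k h u x)|) l))

end QMF

end

noncomputable section

namespace QMF

/-! ### Words of partial quotients, most recent digit first -/

/-! Write a finite expansion as a word of digits, newest first; `ratio` is then q_{r-1}/q_r, which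
for odd r is the modular inverse of the convergent (`modInv_convergent`). Iterating the reciprocity
and periodicity relations peels off one digit at a time, so the r-th approximant to f† is ϑ f(-1)
plus a sum over i ≤ r of unimodular multiples of q_i^{-Re k} h(±q_{i-1}/q_i)
(`IsTwistedQMF.psum_eq`). Denominators grow exponentially, while almost everywhere the digits grow
only polynomially, by Borel–Cantelli. The series therefore converges almost everywhere, and its
remainder after a word u is at most q(u)^{-Re k} times a majorant depending only on the remaining
digits (`Growth.tendsto_daggerApprox`).

Continuity of the distribution function means absence of atoms. If a level set φ ∘ f† = r had
positive measure, Lebesgue density would give a point x such that, for every fixed word w,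
prolonging a long initial word of x by w leads to a cylinder that meets the level set at a point
with controlled tail (`exists_density_point`). All these partial sums are then within O(q^{-Re k})
of r under φ (`NearLevel`), although w is free.

If h is unbounded, prolong by one of two congruent digits whose logarithms differ by a prescribed
amount. The two new terms differ by q^{-Re k} times an expression that the liminf hypothesis makes
arbitrarily large (`NearLevel.false_of_unbounded`). If h is bounded, first prolonging by a huge
digit shows that the O-constant is arbitrarily small (`NearLevel.mono_of_bounded`), so every
normalized new term tends to 0 under φ. Prolongations can steer the argument of h towards α and also
adjust the phase, which contradicts the non-vanishing hypothesis. -/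

/-- The continuant recursion on words (most recent digit first), with initial pair `s`. -/
def cont (s : ℕ × ℕ) : List ℕ → ℕ × ℕ
  | [] => s
  | b :: v => (b * (cont s v).1 + (cont s v).2, (cont s v).1)

/-- Denominator of the convergent of a word. -/
def den (v : List ℕ) : ℕ := (cont (1, 0) v).1
/-- Denominator of the previous convergent. -/
def den' (v : List ℕ) : ℕ := (cont (1, 0) v).2
/-- Numerator of the convergent of a word. -/
def num (v : List ℕ) : ℕ := (cont (0, 1) v).1
/-- Numerator of the previous convergent. -/
def num' (v : List ℕ) : ℕ := (cont (0, 1) v).2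

@[simp] lemma den_nil : den [] = 1 := rfl
@[simp] lemma den'_nil : den' [] = 0 := rfl
@[simp] lemma num_nil : num [] = 0 := rfl
@[simp] lemma num'_nil : num' [] = 1 := rfl
@[simp] lemma den_cons (b : ℕ) (v : List ℕ) : den (b :: v) = b * den v + den' v := rfl
@[simp] lemma den'_cons (b : ℕ) (v : List ℕ) : den' (b :: v) = den v := rfl
@[simp] lemma num_cons (b : ℕ) (v : List ℕ) : num (b :: v) = b * num v + num' v := rfl
@[simp] lemma num'_cons (b : ℕ) (v : List ℕ) : num' (b :: v) = num v := rfl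

/-- All digits of the word are positive. -/
def PosWord (v : List ℕ) : Prop := ∀ b ∈ v, 0 < b

@[simp] lemma posWord_nil : PosWord [] := by simp [PosWord]

@[simp] lemma posWord_cons {b : ℕ} {v : List ℕ} : PosWord (b :: v) ↔ 0 < b ∧ PosWord v := by
  simp [PosWord]

@[simp] lemma posWord_append {w v : List ℕ} : PosWord (w ++ v) ↔ PosWord w ∧ PosWord v := by
  simp [PosWord, or_imp, forall_and]

@[simp] lemma posWord_reverse {v : List ℕ} : PosWord v.reverse ↔ PosWord v := by
  simp [PosWord]

lemma den_pos {v : List ℕ} (hv : PosWord v) : 0 < den v := by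
  induction v with
  | nil => simp
  | cons b v ih =>
    rw [posWord_cons] at hv
    have := ih hv.2
    have := Nat.mul_pos hv.1 this
    simp; omega

lemma den'_le_den {v : List ℕ} (hv : PosWord v) : den' v ≤ den v := by
  cases v with
  | nil => simp
  | cons b v =>
    rw [posWord_cons] at hv
    have := Nat.le_mul_of_pos_left (den v) hv.1
    simp; omega

lemma det_word (v : List ℕ) :
    (num v : ℤ) * den' v - num' v * den v = (-1) ^ (v.length + 1) := by
  induction v with
  | nil => simp
  | cons b v ih =>
    have : (num (b :: v) : ℤ) * den' (b :: v) - num' (b :: v) * den (b :: v) =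
        -((num v : ℤ) * den' v - num' v * den v) := by
      simp; ring
    rw [this, ih]; simp [pow_succ]

lemma den_cons_le {b : ℕ} {v : List ℕ} (hv : PosWord v) : den (b :: v) ≤ (b + 1) * den v := by
  have := den'_le_den hv
  simp; linarith

lemma mul_den_le_den_cons (b : ℕ) (v : List ℕ) : b * den v ≤ den (b :: v) := by
  simp

/-- The denominator of a concatenation is comparable to that of the older word. -/
lemma exists_den_append_le (w : List ℕ) (hw : PosWord w) :
    ∃ c : ℕ, 0 < c ∧ ∀ v, PosWord v → den (w ++ v) ≤ c * den v := by
  induction w with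
  | nil => exact ⟨1, one_pos, fun v _ => by simp⟩
  | cons b w ih =>
    rw [posWord_cons] at hw
    obtain ⟨c, hc, h⟩ := ih hw.2
    refine ⟨(b + 1) * c, by positivity, fun v hv => ?_⟩
    have h1 : PosWord (w ++ v) := by simp [hw.2, hv]
    calc den (b :: (w ++ v)) ≤ (b + 1) * den (w ++ v) := den_cons_le h1
      _ ≤ (b + 1) * (c * den v) := Nat.mul_le_mul_left _ (h v hv)
      _ = _ := by ring

/-- The potential q_r + q_{r-1}/2 grows by a factor of at least 3/2 with each digit; it lies between
q_r and (3/2) q_r, whence the constant 2/3. -/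
lemma den_append_ge {w v : List ℕ} (hw : PosWord w) (hv : PosWord v) :
    (2 / 3 : ℝ) * (3 / 2) ^ w.length * den v ≤ den (w ++ v) := by
  have key : (3 / 2 : ℝ) ^ w.length * (den v + den' v / 2) ≤
      den (w ++ v) + den' (w ++ v) / 2 := by
    induction w with
    | nil => simp
    | cons b w ih =>
      rw [posWord_cons] at hw
      have := ih hw.2
      have hb : (1 : ℝ) ≤ b := by exact_mod_cast hw.1
      have h0 : (0 : ℝ) ≤ den (w ++ v) := by positivity
      have h1 : (0 : ℝ) ≤ den' (w ++ v) := by positivity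
      have h2 : (den (w ++ v) : ℝ) ≤ b * den (w ++ v) := le_mul_of_one_le_left h0 hb
      simp only [List.length_cons, pow_succ, List.cons_append, den_cons, den'_cons]
      push_cast
      nlinarith
  have h1 : PosWord (w ++ v) := by simp [hw, hv]
  have h2 : (den' (w ++ v) : ℝ) ≤ den (w ++ v) := by exact_mod_cast den'_le_den h1
  have h3 : (0 : ℝ) ≤ (3 / 2 : ℝ) ^ w.length * (den' v / 2) := by positivity
  nlinarith

/-- Dependence of the denominator of `l ++ v` on the older word `v`. -/
lemma exists_den_append_eq (l : List ℕ) (hl : PosWord l) :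
    ∃ A B : ℕ, 0 < A ∧ B ≤ A ∧ ∀ v, den (l ++ v) = A * den v + B * den' v := by
  -- `B ≤ A` alone is not inductive: a new digit 1 turns the pair into (A + A', B + B'), so the sums
  -- must be compared as well.
  suffices ∃ A B A' B' : ℕ, 0 < A ∧ B ≤ A ∧ B + B' ≤ A + A' ∧
      ∀ v, den (l ++ v) = A * den v + B * den' v ∧ den' (l ++ v) = A' * den v + B' * den' v by
    obtain ⟨A, B, _, _, h1, h2, _, h3⟩ := this
    exact ⟨A, B, h1, h2, fun v => (h3 v).1⟩
  induction l with
  | nil => exact ⟨1, 0, 0, 1, by simp⟩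
  | cons b l ih =>
    rw [posWord_cons] at hl
    obtain ⟨A, B, A', B', hA, hBA, hs, h⟩ := ih hl.2
    obtain ⟨c, rfl⟩ : ∃ c, b = c + 1 := ⟨b - 1, by omega⟩
    refine ⟨(c + 1) * A + A', (c + 1) * B + B', A, B, by positivity, ?_, ?_, fun v => ?_⟩
    · have := Nat.mul_le_mul_left c hBA
      linarith
    · have := Nat.mul_le_mul_left c hBA
      linarith
    · simp only [List.cons_append, den_cons, den'_cons, (h v).1, (h v).2]
      exact ⟨by ring, trivial⟩

/-- The ratio `q_{r-1}/q_r` attached to a word. -/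
def ratio (v : List ℕ) : ℚ := (den' v : ℚ) / den v

lemma ratio_cons {b : ℕ} {v : List ℕ} (hv : PosWord v) :
    ratio (b :: v) = 1 / (b + ratio v) := by
  have : (den v : ℚ) ≠ 0 := by exact_mod_cast (den_pos hv).ne'
  simp only [ratio, den_cons, den'_cons]
  push_cast
  field_simp

lemma ratio_nonneg (v : List ℕ) : 0 ≤ ratio v := by unfold ratio; positivity

lemma ratio_le_one {v : List ℕ} (hv : PosWord v) : ratio v ≤ 1 := by
  unfold ratio
  exact div_le_one_of_le₀ (by exact_mod_cast den'_le_den hv) (by positivity)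

lemma ratio_pos {v : List ℕ} (hv : PosWord v) (hne : v ≠ []) : 0 < ratio v := by
  cases v with
  | nil => exact absurd rfl hne
  | cons b v =>
    have h1 := den_pos hv
    rw [posWord_cons] at hv
    have h2 := den_pos hv.2
    simp only [ratio, den'_cons]
    positivity

/-- The inverse branch of the iterated Gauss map attached to a word. -/
def mobius (v : List ℕ) (t : ℝ) : ℝ := (num v + num' v * t) / (den v + den' v * t)

lemma mobius_den_pos {v : List ℕ} (hv : PosWord v) {t : ℝ} (ht : 0 ≤ t) :
    0 < (den v : ℝ) + den' v * t := by
  have : (0 : ℝ) < den v := by exact_mod_cast den_pos hv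
  positivity

@[simp] lemma mobius_nil (t : ℝ) : mobius [] t = t := by simp [mobius]

lemma mobius_cons {b : ℕ} {v : List ℕ} (hv : PosWord v) (hb : 0 < b) {t : ℝ} (ht : 0 ≤ t) :
    mobius (b :: v) t = mobius v (1 / (b + t)) := by
  have hb' : (0 : ℝ) < b := by exact_mod_cast hb
  have h1 := mobius_den_pos hv (t := 1 / (b + t)) (by positivity)
  have h2 := mobius_den_pos (v := b :: v) (by simp [hb, hv]) ht
  simp only [mobius]
  rw [div_eq_div_iff h2.ne' h1.ne']
  simp only [den_cons, den'_cons, num_cons, num'_cons]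
  push_cast
  field_simp
  ring

/-- The branch is a Möbius map of determinant ±1. Since q_{r-1} ≤ q_r, its contraction on [0, 1]
lies between 1/(4q²) and 1/q²; this bounded distortion is all the metric theory needs. -/
lemma mobius_sub {v : List ℕ} (hv : PosWord v) {s t : ℝ} (hs : 0 ≤ s) (ht : 0 ≤ t) :
    |mobius v s - mobius v t| =
      |s - t| / ((den v + den' v * s) * (den v + den' v * t)) := by
  have h1 := mobius_den_pos hv hs
  have h2 := mobius_den_pos hv ht
  have hd : (num v : ℝ) * den' v - num' v * den v = (-1) ^ (v.length + 1) := by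
    exact_mod_cast congrArg (Int.cast (R := ℝ)) (det_word v)
  have : mobius v s - mobius v t =
      (-((num v : ℝ) * den' v - num' v * den v)) * (s - t) /
        ((den v + den' v * s) * (den v + den' v * t)) := by
    unfold mobius
    rw [div_sub_div _ _ h1.ne' h2.ne']
    congr 1; ring
  rw [this, hd, abs_div, abs_mul, abs_neg, abs_pow, abs_neg, abs_one, one_pow, one_mul,
    abs_of_pos (mul_pos h1 h2)]

lemma mobius_sub_le {v : List ℕ} (hv : PosWord v) {s t : ℝ} (hs : 0 ≤ s) (ht : 0 ≤ t) :
    |mobius v s - mobius v t| ≤ ((den v : ℝ) ^ 2)⁻¹ * |s - t| := by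
  have h0 : (0 : ℝ) < den v := by exact_mod_cast den_pos hv
  rw [mobius_sub hv hs ht, div_eq_inv_mul]
  gcongr
  rw [sq]
  gcongr <;> exact le_add_of_nonneg_right (by positivity)

lemma le_mobius_sub {v : List ℕ} (hv : PosWord v) {s t : ℝ} (hs : s ∈ Set.Icc (0 : ℝ) 1)
    (ht : t ∈ Set.Icc (0 : ℝ) 1) :
    |s - t| ≤ 4 * (den v : ℝ) ^ 2 * |mobius v s - mobius v t| := by
  have h1 := mobius_den_pos hv hs.1
  have h2 := mobius_den_pos hv ht.1
  have h3 : (den' v : ℝ) ≤ den v := by exact_mod_cast den'_le_den hv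
  have h0 : (0 : ℝ) ≤ den' v := by positivity
  have h4 : (den v : ℝ) + den' v * s ≤ 2 * den v := by nlinarith [hs.2, hs.1]
  have h5 : (den v : ℝ) + den' v * t ≤ 2 * den v := by nlinarith [ht.2, ht.1]
  have h6 : ((den v : ℝ) + den' v * s) * (den v + den' v * t) ≤ 4 * (den v : ℝ) ^ 2 := by
    calc _ ≤ (2 * (den v : ℝ)) * (2 * den v) := by gcongr
      _ = _ := by ring
  rw [mobius_sub hv hs.1 ht.1, mul_div_assoc', le_div_iff₀ (mul_pos h1 h2), mul_comm |s - t|]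
  exact mul_le_mul_of_nonneg_right h6 (abs_nonneg _)

/-- Both `ratio_cons` and `mobius_cons` substitute 1/(b + t) for t. Hence the newest digits of a
word, read in order, are the leading digits of its ratio, and prolongation can steer the ratio
anywhere. -/
lemma ratio_reverse_append {v u : List ℕ} (hv : PosWord v) (hu : PosWord u) :
    (ratio (v.reverse ++ u) : ℝ) = mobius v (ratio u) := by
  induction v generalizing u with
  | nil => simp
  | cons b v ih =>
    rw [posWord_cons] at hv
    have h : PosWord (b :: u) := by simp [hv.1, hu]
    have h0 : (0 : ℝ) ≤ ratio u := by exact_mod_cast ratio_nonneg u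
    rw [List.reverse_cons, List.append_assoc, List.singleton_append, ih hv.2 h, ratio_cons hu,
      mobius_cons hv.2 hv.1 h0]
    push_cast; rfl

/-! ### The Gauss map -/

/-- The Gauss map. -/
def gaussMap (x : ℝ) : ℝ := Int.fract x⁻¹

/-- The irrational numbers of the unit interval. -/
def unitIrr : Set ℝ := {x | x ∈ Set.Ioo (0 : ℝ) 1 ∧ Irrational x}

/-- The partial quotient of index `n + 1` of a number of the unit interval. -/
def digit (x : ℝ) (n : ℕ) : ℕ := ⌊(gaussMap^[n] x)⁻¹⌋₊

/-- The word of the first `n` partial quotients. -/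
def word (x : ℝ) : ℕ → List ℕ
  | 0 => []
  | n + 1 => digit x n :: word x n

@[simp] lemma word_zero (x : ℝ) : word x 0 = [] := rfl
@[simp] lemma word_succ (x : ℝ) (n : ℕ) : word x (n + 1) = digit x n :: word x n := rfl
@[simp] lemma length_word (x : ℝ) (n : ℕ) : (word x n).length = n := by
  induction n with
  | zero => rfl
  | succ n ih => simp [ih]

lemma gaussMap_mem {x : ℝ} (hx : x ∈ unitIrr) : gaussMap x ∈ unitIrr := by
  have h : Irrational (gaussMap x) := by
    have := (irrational_inv_iff.2 hx.2).sub_intCast ⌊x⁻¹⌋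
    exact this
  refine ⟨⟨lt_of_le_of_ne (Int.fract_nonneg _) ?_, Int.fract_lt_one _⟩, h⟩
  exact fun h0 => h.ne_zero h0.symm

lemma iterate_gaussMap_mem {x : ℝ} (hx : x ∈ unitIrr) (n : ℕ) : gaussMap^[n] x ∈ unitIrr := by
  induction n with
  | zero => exact hx
  | succ n ih => rw [Function.iterate_succ_apply']; exact gaussMap_mem ih

lemma digit_succ (x : ℝ) (n : ℕ) : digit x (n + 1) = digit (gaussMap x) n := by
  simp [digit]

lemma eq_one_div_digit_zero_add {x : ℝ} (hx : x ∈ unitIrr) : x = 1 / (digit x 0 + gaussMap x) := by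
  have h0 : 0 ≤ x⁻¹ := inv_nonneg.2 hx.1.1.le
  have : (digit x 0 : ℝ) + gaussMap x = x⁻¹ := by
    simp only [digit, gaussMap, Function.iterate_zero, id]
    rw [natCast_floor_eq_intCast_floor h0]
    exact Int.floor_add_fract _
  rw [this]; simp

lemma iterate_gaussMap_eq {x : ℝ} (hx : x ∈ unitIrr) (n : ℕ) :
    gaussMap^[n] x = 1 / (digit x n + gaussMap^[n + 1] x) := by
  have := eq_one_div_digit_zero_add (iterate_gaussMap_mem hx n)
  rwa [← Function.iterate_succ_apply' gaussMap] at this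

lemma digit_pos {x : ℝ} (hx : x ∈ unitIrr) (n : ℕ) : 0 < digit x n := by
  have h := iterate_gaussMap_mem hx n
  exact Nat.floor_pos.2 ((one_le_inv₀ h.1.1).2 h.1.2.le)

lemma posWord_word {x : ℝ} (hx : x ∈ unitIrr) (n : ℕ) : PosWord (word x n) := by
  induction n with
  | zero => simp
  | succ n ih => simp [ih, digit_pos hx n]

lemma mobius_word {x : ℝ} (hx : x ∈ unitIrr) (n : ℕ) :
    mobius (word x n) (gaussMap^[n] x) = x := by
  induction n with
  | zero => simp
  | succ n ih =>
    rw [word_succ, mobius_cons (posWord_word hx n) (digit_pos hx n)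
      (iterate_gaussMap_mem hx _).1.1.le, ← iterate_gaussMap_eq hx, ih]

lemma one_div_add_mem {b : ℕ} (hb : 0 < b) {t : ℝ} (ht : t ∈ unitIrr) :
    1 / (b + t) ∈ unitIrr := by
  have hb' : (1 : ℝ) ≤ b := by exact_mod_cast hb
  have h1 : (0 : ℝ) < b + t := by linarith [ht.1.1]
  refine ⟨⟨by positivity, (div_lt_one h1).2 (by linarith [ht.1.1])⟩, ?_⟩
  rw [one_div, irrational_inv_iff]
  exact ht.2.natCast_add b

lemma gaussMap_one_div_add {b : ℕ} {t : ℝ} (ht : t ∈ unitIrr) :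
    gaussMap (1 / (b + t)) = t := by
  rw [gaussMap, one_div, inv_inv, Int.fract_natCast_add]
  exact Int.fract_eq_self.2 ⟨ht.1.1.le, ht.1.2⟩

lemma digit_one_div_add {b : ℕ} {t : ℝ} (ht : t ∈ unitIrr) :
    digit (1 / (b + t)) 0 = b := by
  simp only [digit, Function.iterate_zero, id, one_div, inv_inv]
  rw [add_comm, Nat.floor_add_natCast ht.1.1.le, Nat.floor_eq_zero.2 ht.1.2, zero_add]

/-- The image of `mobius v` is the cylinder of v: the word can be read back from any of its points,
so cylinders of equal length are disjoint. -/
lemma mobius_spec {v : List ℕ} (hv : PosWord v) {t : ℝ} (ht : t ∈ unitIrr) :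
    mobius v t ∈ unitIrr ∧ gaussMap^[v.length] (mobius v t) = t ∧
      word (mobius v t) v.length = v := by
  induction v generalizing t with
  | nil => simpa using ht
  | cons b v ih =>
    rw [posWord_cons] at hv
    obtain ⟨h1, h2, h3⟩ := ih hv.2 (one_div_add_mem hv.1 ht)
    rw [mobius_cons hv.2 hv.1 ht.1.1.le]
    refine ⟨h1, ?_, ?_⟩
    · rw [List.length_cons, Function.iterate_succ_apply', h2, gaussMap_one_div_add ht]
    · rw [List.length_cons, word_succ, h3]
      congr 1
      have := digit_one_div_add (b := b) ht
      simp only [digit] at this ⊢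
      rw [h2]; simpa using this

lemma word_add (x : ℝ) (n j : ℕ) :
    word x (n + j) = word (gaussMap^[n] x) j ++ word x n := by
  induction j with
  | zero => simp
  | succ j ih =>
    rw [← add_assoc, word_succ, ih, word_succ, List.cons_append]
    congr 1
    simp only [digit]
    rw [add_comm n j, Function.iterate_add_apply]

lemma word_mobius_add {v : List ℕ} (hv : PosWord v) {t : ℝ} (ht : t ∈ unitIrr) (j : ℕ) :
    word (mobius v t) (v.length + j) = word t j ++ v := by
  obtain ⟨_, h2, h3⟩ := mobius_spec hv ht
  rw [word_add, h2, h3]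

/-! ### Convergents -/

/-- `mobius_cons` peels off the newest digit, whereas the recursion for convergents peels off the
oldest one; this reconciles the two. -/
lemma mobius_word_succ {x : ℝ} (hx : x ∈ unitIrr) (n : ℕ) {s : ℝ} (hs : 0 ≤ s) :
    mobius (word x (n + 1)) s = 1 / (digit x 0 + mobius (word (gaussMap x) n) s) := by
  induction n generalizing s with
  | zero => 
    rw [word_succ, mobius_cons (posWord_word hx _) (digit_pos hx _) hs]; simp
  | succ n ih =>
    have h : (0 : ℝ) ≤ 1 / (digit x (n + 1) + s) := by positivity
    rw [word_succ, mobius_cons (posWord_word hx _) (digit_pos hx _) hs, ih h,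
      word_succ (gaussMap x), mobius_cons (posWord_word (gaussMap_mem hx) _)
      (digit_pos (gaussMap_mem hx) _) hs, ← digit_succ]

lemma convergent_succ_of_mem {x : ℝ} (hx : x ∈ unitIrr) (n : ℕ) :
    x.convergent (n + 1) = 1 / (digit x 0 + (gaussMap x).convergent n) := by
  have h0 : ⌊x⌋ = 0 := Int.floor_eq_zero_iff.2 ⟨hx.1.1.le, hx.1.2⟩
  have h1 : Int.fract x = x := Int.fract_eq_self.2 ⟨hx.1.1.le, hx.1.2⟩
  have hd : (⌊x⁻¹⌋ : ℚ) = digit x 0 := by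
    have := natCast_floor_eq_intCast_floor (R := ℝ) (inv_nonneg.2 hx.1.1.le)
    simp only [digit, Function.iterate_zero, id]
    exact_mod_cast this.symm
  have hg : ⌊gaussMap x⌋ = 0 := by
    simp [gaussMap]
  rw [Real.convergent_succ, h0, h1, Int.cast_zero, zero_add, one_div]
  congr 1
  cases n with
  | zero => simp [hg, hd]
  | succ n => 
    rw [Real.convergent_succ, Real.convergent_succ, hg, hd]
    simp [gaussMap]

lemma convergent_eq_mobius {x : ℝ} (hx : x ∈ unitIrr) (n : ℕ) :
    (x.convergent n : ℝ) = mobius (word x n) 0 := by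
  induction n generalizing x with
  | zero => 
    have h0 : ⌊x⌋ = 0 := Int.floor_eq_zero_iff.2 ⟨hx.1.1.le, hx.1.2⟩
    simp [h0]
  | succ n ih =>
    rw [convergent_succ_of_mem hx, mobius_word_succ hx n le_rfl, ← ih (gaussMap_mem hx)]
    push_cast; rfl

lemma num_coprime_den (v : List ℕ) : (num v).Coprime (den v) := by
  have h := det_word v
  rw [← Nat.isCoprime_iff_coprime]
  have h2 : ((-1 : ℤ) ^ (v.length + 1)) * (-1) ^ (v.length + 1) = 1 := by
    rw [← mul_pow]; simp
  refine ⟨(-1) ^ (v.length + 1) * den' v, -(-1) ^ (v.length + 1) * num' v, ?_⟩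
  linear_combination h2 + (-1 : ℤ) ^ (v.length + 1) * h

lemma convergent_eq_div {x : ℝ} (hx : x ∈ unitIrr) (n : ℕ) :
    x.convergent n = (num (word x n) : ℚ) / den (word x n) := by
  have := convergent_eq_mobius hx n
  simp only [mobius, mul_zero, add_zero] at this
  apply Rat.cast_injective (α := ℝ)
  rw [this]; push_cast; rfl

lemma convergent_den {x : ℝ} (hx : x ∈ unitIrr) (n : ℕ) :
    (x.convergent n).den = den (word x n) := by
  rw [convergent_eq_div hx]
  have := Rat.den_div_eq_of_coprime (a := num (word x n)) (b := den (word x n))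
    (by exact_mod_cast den_pos (posWord_word hx n)) (by simpa using num_coprime_den _)
  simpa using this

lemma convergent_num {x : ℝ} (hx : x ∈ unitIrr) (n : ℕ) :
    (x.convergent n).num = num (word x n) := by
  rw [convergent_eq_div hx]
  have := Rat.num_div_eq_of_coprime (a := num (word x n)) (b := den (word x n))
    (by exact_mod_cast den_pos (posWord_word hx n)) (by simpa using num_coprime_den _)
  simpa using this

/-- For odd n the determinant identity reads a_n q_{n-1} ≡ 1 mod q_n, with the plus sign. -/
lemma modInv_convergent {x : ℝ} (hx : x ∈ unitIrr) {n : ℕ} (hn : Odd n) :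
    modInv (x.convergent n) = ratio (word x n) := by
  have hp := posWord_word hx n
  have hdet := det_word (word x n)
  rw [length_word, (hn.add_one).neg_one_pow] at hdet
  have hle := den'_le_den hp
  have hpos := den_pos hp
  have hd := convergent_den hx n
  have hm := convergent_num hx n
  unfold modInv ratio
  by_cases h1 : den (word x n) = 1
  -- Denominator 1 is where the representative in (0, q] is q itself; the determinant excludes
  -- q_{n-1} = 0.
  · rw [if_pos (by rw [hd, h1])]
    have : den' (word x n) = 1 := by
      rcases Nat.eq_zero_or_pos (den' (word x n)) with h | h
      · rw [h, h1] at hdet; simp at hdet; omega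
      · omega
    simp [h1, this]
  · rw [if_neg (by rw [hd]; exact h1), hm, hd]
    have hlt : den' (word x n) < den (word x n) := by
      refine lt_of_le_of_ne hle fun h => h1 ?_
      rw [h, ← sub_mul] at hdet
      have : (den (word x n) : ℤ) ∣ 1 := ⟨_, by rw [mul_comm]; exact hdet.symm⟩
      have := Int.eq_one_of_dvd_one (by positivity) this
      exact_mod_cast this
    have : NeZero (den (word x n)) := ⟨hpos.ne'⟩
    have hinv : ((num (word x n) : ℤ) : ZMod (den (word x n))) * (den' (word x n)) = 1 := by
      have := congrArg (Int.cast (R := ZMod (den (word x n)))) hdet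
      push_cast at this
      simpa using this
    have : (((num (word x n) : ℤ) : ZMod (den (word x n))))⁻¹ = (den' (word x n) : ZMod _) :=
      ZMod.inv_eq_of_mul_eq_one _ _ _ hinv
    rw [this, ZMod.val_natCast, Nat.mod_eq_of_lt hlt]

/-! ### Metric theory of the Gauss map -/

/-- One-dimensional Hausdorff measure is Lebesgue measure, so no measurability of s is needed. -/
lemma volume_image_le_of_dist {f : ℝ → ℝ} {s : Set ℝ} {C : ℝ} (hC : 0 ≤ C)
    (h : ∀ x ∈ s, ∀ y ∈ s, |f x - f y| ≤ C * |x - y|) :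
    volume (f '' s) ≤ ENNReal.ofReal C * volume s := by
  have hl : LipschitzOnWith C.toNNReal f s := by
    refine LipschitzOnWith.of_dist_le_mul fun x hx y hy => ?_
    rw [Real.coe_toNNReal _ hC, Real.dist_eq, Real.dist_eq]
    exact h x hx y hy
  have := hl.hausdorffMeasure_image_le (d := 1) zero_le_one
  rwa [hausdorffMeasure_real, ENNReal.rpow_one] at this

lemma measurableSet_unitIrr : MeasurableSet unitIrr := by
  have h : MeasurableSet {x : ℝ | Irrational x} := by
    have : {x : ℝ | Irrational x} = (Set.range ((↑) : ℚ → ℝ))ᶜ := rfl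
    rw [this]
    exact (Set.countable_range _).measurableSet.compl
  exact measurableSet_Ioo.inter h

lemma ae_irrational : ∀ᵐ x : ℝ, Irrational x := by
  have : (Set.range ((↑) : ℚ → ℝ)).Countable := Set.countable_range _
  exact this.ae_notMem volume

lemma ae_mem_unitIrr : ∀ᵐ x ∂(volume.restrict (Set.Icc (0 : ℝ) 1)), x ∈ unitIrr := by
  rw [ae_restrict_iff' measurableSet_Icc]
  filter_upwards [ae_irrational] with x hx h
  refine ⟨⟨lt_of_le_of_ne h.1 fun h0 => hx.ne_zero h0.symm,
    lt_of_le_of_ne h.2 fun h0 => hx.ne_one h0⟩, hx⟩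

lemma volume_unitIrr : volume unitIrr = 1 := by
  have : unitIrr =ᵐ[volume] Set.Ioo (0 : ℝ) 1 := by
    filter_upwards [ae_irrational] with x hx
    exact propext ⟨fun h => h.1, fun h => ⟨h, hx⟩⟩
  rw [measure_congr this]; simp

lemma volume_mobius_image_le {v : List ℕ} (hv : PosWord v) {A : Set ℝ} (hA : A ⊆ unitIrr) :
    volume (mobius v '' A) ≤ ENNReal.ofReal ((den v : ℝ) ^ 2)⁻¹ * volume A :=
  volume_image_le_of_dist (by positivity) fun _ hx _ hy =>
    mobius_sub_le hv (hA hx).1.1.le (hA hy).1.1.le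

/-- The iterated Gauss map is 4q²-Lipschitz on the cylinder and maps it onto the irrationals of the
unit interval, which have measure 1. -/
lemma one_le_volume_mobius_image {v : List ℕ} (hv : PosWord v) :
    1 ≤ ENNReal.ofReal (4 * (den v : ℝ) ^ 2) * volume (mobius v '' unitIrr) := by
  have h : gaussMap^[v.length] '' (mobius v '' unitIrr) = unitIrr := by
    rw [Set.image_image]
    exact (Set.image_congr fun t ht => (mobius_spec hv ht).2.1).trans (Set.image_id' _)
  rw [← volume_unitIrr, ← h]
  nth_rewrite 2 [h]
  refine volume_image_le_of_dist (by positivity) ?_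
  rintro _ ⟨s, hs, rfl⟩ _ ⟨t, ht, rfl⟩
  rw [(mobius_spec hv hs).2.1, (mobius_spec hv ht).2.1]
  exact le_mobius_sub hv ⟨hs.1.1.le, hs.1.2.le⟩ ⟨ht.1.1.le, ht.1.2.le⟩

lemma measurableSet_mobius_image {v : List ℕ} (hv : PosWord v) :
    MeasurableSet (mobius v '' unitIrr) := by
  refine measurableSet_unitIrr.image_of_continuousOn_injOn ?_ ?_
  · unfold mobius
    refine ContinuousOn.div (by fun_prop) (by fun_prop) fun t ht => ?_
    exact (mobius_den_pos hv ht.1.1.le).ne'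
  · intro s hs t ht h
    have h1 := (mobius_spec hv hs).2.1
    have h2 := (mobius_spec hv ht).2.1
    rw [← h1, ← h2]
    exact congrArg _ h

/-- By bounded distortion the preimage of A fills at most a proportion 4|A| of each cylinder of
length n. Summing over the disjoint cylinders replaces an appeal to the invariant Gauss measure. -/
lemma volume_iterate_preimage_le (A : Set ℝ) (n : ℕ) :
    volume {x | x ∈ unitIrr ∧ gaussMap^[n] x ∈ A} ≤ 4 * volume A := by
  let W := {v : List ℕ // PosWord v ∧ v.length = n}
  have hsub : {x | x ∈ unitIrr ∧ gaussMap^[n] x ∈ A} ⊆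
      ⋃ v : W, mobius v.1 '' (A ∩ unitIrr) := by
    rintro x ⟨hx, hxA⟩
    refine Set.mem_iUnion.2 ⟨⟨word x n, posWord_word hx n, length_word x n⟩, ?_⟩
    exact ⟨_, ⟨hxA, iterate_gaussMap_mem hx n⟩, mobius_word hx n⟩
  have hv : ∀ v : W, volume (mobius v.1 '' (A ∩ unitIrr)) ≤
      4 * volume A * volume (mobius v.1 '' unitIrr) := by
    intro v
    have hd : (0 : ℝ) < den v.1 := by exact_mod_cast den_pos v.2.1
    calc volume (mobius v.1 '' (A ∩ unitIrr))
        ≤ ENNReal.ofReal ((den v.1 : ℝ) ^ 2)⁻¹ * volume (A ∩ unitIrr) :=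
          volume_mobius_image_le v.2.1 Set.inter_subset_right
      _ ≤ ENNReal.ofReal ((den v.1 : ℝ) ^ 2)⁻¹ * volume A * 1 := by
          rw [mul_one]; gcongr; exact Set.inter_subset_left
      _ ≤ ENNReal.ofReal ((den v.1 : ℝ) ^ 2)⁻¹ * volume A *
          (ENNReal.ofReal (4 * (den v.1 : ℝ) ^ 2) * volume (mobius v.1 '' unitIrr)) := by
          gcongr; exact one_le_volume_mobius_image v.2.1
      _ = (ENNReal.ofReal ((den v.1 : ℝ) ^ 2)⁻¹ * ENNReal.ofReal (4 * (den v.1 : ℝ) ^ 2)) *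
          volume A * volume (mobius v.1 '' unitIrr) := by ring
      _ = _ := by
          rw [← ENNReal.ofReal_mul (by positivity)]
          have : ((den v.1 : ℝ) ^ 2)⁻¹ * (4 * (den v.1 : ℝ) ^ 2) = 4 := by field_simp
          rw [this]; norm_num
  have hdisj : Pairwise (Function.onFun Disjoint fun v : W => mobius v.1 '' unitIrr) := by
    intro v w hvw
    refine Set.disjoint_left.2 ?_
    rintro _ ⟨s, hs, rfl⟩ ⟨t, ht, h⟩
    have h1 := (mobius_spec v.2.1 hs).2.2
    have h2 := (mobius_spec w.2.1 ht).2.2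
    rw [v.2.2] at h1
    rw [w.2.2, h] at h2
    exact hvw (Subtype.ext (h1.symm.trans h2))
  calc _ ≤ volume (⋃ v : W, mobius v.1 '' (A ∩ unitIrr)) := measure_mono hsub
    _ ≤ ∑' v : W, volume (mobius v.1 '' (A ∩ unitIrr)) := measure_iUnion_le _
    _ ≤ ∑' v : W, 4 * volume A * volume (mobius v.1 '' unitIrr) := ENNReal.tsum_le_tsum hv
    _ = 4 * volume A * volume (⋃ v : W, mobius v.1 '' unitIrr) := by
        rw [ENNReal.tsum_mul_left, measure_iUnion hdisj
          fun v => measurableSet_mobius_image v.2.1]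
    _ ≤ 4 * volume A * volume unitIrr := by
        gcongr
        refine Set.iUnion_subset fun v => ?_
        rintro _ ⟨t, ht, rfl⟩
        exact (mobius_spec v.2.1 ht).1
    _ = _ := by rw [volume_unitIrr, mul_one]

lemma le_den_word {x : ℝ} (hx : x ∈ unitIrr) (n : ℕ) :
    (2 / 3 : ℝ) * (3 / 2) ^ n ≤ den (word x n) := by
  simpa using den_append_ge (posWord_word hx n) posWord_nil

lemma tendsto_den_word {x : ℝ} (hx : x ∈ unitIrr) :
    Tendsto (fun n => (den (word x n) : ℝ)) atTop atTop :=
  tendsto_atTop_mono (le_den_word hx)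
    ((tendsto_pow_atTop_atTop_of_one_lt (by norm_num)).const_mul_atTop (by norm_num))

/-- In a set of positive measure there is a point such that every refinement of its cylinders by a
fixed word eventually meets the set in a point whose tail avoids a given small set. -/
lemma exists_density_point {E A : Set ℝ} (hE : MeasurableSet E) (hEI : E ⊆ unitIrr)
    (hpos : volume E ≠ 0) (hA : A ⊆ unitIrr) (hAvol : volume A ≤ ENNReal.ofReal (1 / 16)) :
    ∃ x ∈ E, ∀ w, PosWord w → ∀ᶠ n in atTop,
      ∃ t ∈ unitIrr \ A, mobius (w ++ word x n) t ∈ E := by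
  obtain ⟨x, hxE, hx⟩ : ∃ x ∈ E, Tendsto (fun r => volume (Eᶜ ∩ Metric.closedBall x r) /
      volume (Metric.closedBall x r)) (𝓝[>] 0) (𝓝 (Eᶜ.indicator 1 x)) := by
    -- Lebesgue density is applied to the complement of E, whose density vanishes at almost every
    -- point of E.
    have h := Besicovitch.ae_tendsto_measure_inter_div_of_measurableSet (volume : Measure ℝ) hE.compl
    by_contra! hcon
    refine hpos (measure_mono_null (fun x hx => ?_) h)
    exact hcon x hx
  rw [Set.indicator_of_notMem (Set.notMem_compl_iff.2 hxE)] at hx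
  have hxI := hEI hxE
  refine ⟨x, hxE, fun w hw => ?_⟩
  obtain ⟨c, hc, hden⟩ := exists_den_append_le w hw
  have hc' : (0 : ℝ) < c := by exact_mod_cast hc
  have hr : Tendsto (fun n => ((den (word x n) : ℝ) ^ 2)⁻¹) atTop (𝓝[>] 0) := by
    refine tendsto_nhdsWithin_iff.2 ⟨?_, Eventually.of_forall fun n => ?_⟩
    · exact tendsto_inv_atTop_zero.comp
        ((tendsto_pow_atTop (α := ℝ) two_ne_zero).comp (tendsto_den_word hxI))
    · have : (0 : ℝ) < den (word x n) := by exact_mod_cast den_pos (posWord_word hxI n)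
      exact Set.mem_Ioi.2 (by positivity)
  -- The refined cylinder has length at least 1/(4d²), where d ≤ c q. With this threshold the
  -- complement of E occupies at most half of 1/(4d²), and the part with tail in A at most a
  -- quarter, so something remains.
  have hη : (0 : ENNReal) < ENNReal.ofReal (1 / (16 * (c : ℝ) ^ 2)) :=
    ENNReal.ofReal_pos.2 (by positivity)
  filter_upwards [hr.eventually (hx.eventually (gt_mem_nhds hη))] with n hn
  by_contra! hcon
  set u := word x n with hu
  have hup : PosWord u := posWord_word hxI n
  have hvp : PosWord (w ++ u) := posWord_append.2 ⟨hw, hup⟩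
  set d : ℝ := (den (w ++ u) : ℝ) with hd
  set du : ℝ := (den u : ℝ) with hdu
  have hd0 : 0 < d := by rw [hd]; exact_mod_cast den_pos hvp
  have hdu0 : 0 < du := by rw [hdu]; exact_mod_cast den_pos hup
  have hddu : d ≤ c * du := by rw [hd, hdu]; exact_mod_cast hden u hup
  have hball : volume (Eᶜ ∩ Metric.closedBall x (du ^ 2)⁻¹) ≤
      ENNReal.ofReal (1 / (16 * (c : ℝ) ^ 2)) * ENNReal.ofReal (2 * (du ^ 2)⁻¹) := by
    have h0 : ENNReal.ofReal (2 * (du ^ 2)⁻¹) ≠ 0 := (ENNReal.ofReal_pos.2 (by positivity)).ne'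
    rw [Real.volume_closedBall] at hn
    exact (ENNReal.div_le_iff h0 ENNReal.ofReal_ne_top).1 hn.le
  have hsub : mobius (w ++ u) '' unitIrr ⊆
      mobius (w ++ u) '' A ∪ (Eᶜ ∩ Metric.closedBall x (du ^ 2)⁻¹) := by
    rintro _ ⟨t, ht, rfl⟩
    by_cases htA : t ∈ A
    · exact Or.inl ⟨t, htA, rfl⟩
    refine Or.inr ⟨hcon t ⟨ht, htA⟩, ?_⟩
    obtain ⟨hz, _, hword⟩ := mobius_spec hvp ht
    set z := mobius (w ++ u) t
    have hzn : word z n = u := by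
      rw [List.length_append, hu, length_word, add_comm, word_add] at hword
      exact (List.append_inj' hword (by simp)).2
    have h1 := mobius_word hz n
    have h2 := mobius_word hxI n
    rw [hzn] at h1
    rw [Metric.mem_closedBall, Real.dist_eq, ← h1, ← h2]
    have hs := iterate_gaussMap_mem hz n
    have ht' := iterate_gaussMap_mem hxI n
    refine (mobius_sub_le hup hs.1.1.le ht'.1.1.le).trans ?_
    refine mul_le_of_le_one_right (by positivity) ?_
    rw [abs_le]
    constructor <;> linarith [hs.1.1, hs.1.2, ht'.1.1, ht'.1.2]
  have h1 := one_le_volume_mobius_image hvp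
  have h2 : volume (mobius (w ++ u) '' unitIrr) ≤
      ENNReal.ofReal ((d ^ 2)⁻¹ * (1 / 16) + 1 / (16 * (c : ℝ) ^ 2) * (2 * (du ^ 2)⁻¹)) := by
    refine (measure_mono hsub).trans ((measure_union_le _ _).trans ?_)
    rw [ENNReal.ofReal_add (by positivity) (by positivity), ENNReal.ofReal_mul (by positivity),
      ENNReal.ofReal_mul (p := 1 / (16 * (c : ℝ) ^ 2)) (by positivity)]
    refine add_le_add ((volume_mobius_image_le hvp hA).trans ?_) hball
    gcongr
  have h3 : (1 : ENNReal) ≤ ENNReal.ofReal (4 * d ^ 2 *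
      ((d ^ 2)⁻¹ * (1 / 16) + 1 / (16 * (c : ℝ) ^ 2) * (2 * (du ^ 2)⁻¹))) := by
    rw [ENNReal.ofReal_mul (by positivity)]
    exact h1.trans (by gcongr)
  rw [ENNReal.one_le_ofReal] at h3
  have h4 : d ^ 2 ≤ (c * du) ^ 2 := by gcongr
  have h5 : 4 * d ^ 2 * ((d ^ 2)⁻¹ * (1 / 16) + 1 / (16 * (c : ℝ) ^ 2) * (2 * (du ^ 2)⁻¹)) =
      1 / 4 + 1 / 2 * (d ^ 2 / (c * du) ^ 2) := by
    field_simp; ring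
  rw [h5] at h3
  have h6 : d ^ 2 / (c * du) ^ 2 ≤ 1 := div_le_one_of_le₀ h4 (by positivity)
  linarith

/-! ### The majorant of the tail -/

/-- A majorant for the tails of the series defining the limit function. -/
def tailSum (ρ s x : ℝ) : ENNReal :=
  ∑' j : ℕ, ENNReal.ofReal (ρ ^ (j + 1) * Real.exp (((digit x j : ℝ) + 1) ^ s))

lemma measurable_gaussMap : Measurable gaussMap := measurable_fract.comp measurable_inv

lemma measurable_digit (n : ℕ) : Measurable fun x => digit x n :=
  Nat.measurable_floor.comp ((measurable_gaussMap.iterate n).inv)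

lemma measurable_tailSum (ρ s : ℝ) : Measurable (tailSum ρ s) := by
  refine Measurable.tsum fun j => ENNReal.measurable_ofReal.comp ?_
  have : Measurable fun x => (digit x j : ℝ) := measurable_from_top.comp (measurable_digit j)
  exact (Real.measurable_exp.comp ((this.add_const 1).pow_const s)).const_mul _

lemma summable_pow_mul_exp_rpow {ρ γ : ℝ} (hρ : ρ ∈ Set.Ioo (0 : ℝ) 1) (hγ : γ < 1) :
    Summable fun j : ℕ => ρ ^ (j + 1) * Real.exp (2 * ((j : ℝ) + 1) ^ γ) := by
  set L := -Real.log ρ with hL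
  have hLpos : 0 < L := neg_pos.2 (Real.log_neg hρ.1 hρ.2)
  have hgeo : Summable fun j : ℕ => Real.exp (-L / 2) ^ j :=
    summable_geometric_of_lt_one (Real.exp_pos _).le (Real.exp_lt_one_iff.2 (by linarith))
  have ht : Tendsto (fun j : ℕ => ((j : ℝ) + 1) ^ (-(1 - γ))) atTop (𝓝 0) :=
    (tendsto_rpow_neg_atTop (by linarith)).comp
      (tendsto_natCast_atTop_atTop.atTop_add tendsto_const_nhds)
  refine Summable.of_norm_bounded_eventually_nat hgeo ?_
  -- With L/4, twice the sublinear power uses up only half of the decay rate L.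
  filter_upwards [ht.eventually (gt_mem_nhds (show (0 : ℝ) < L / 4 by positivity))] with j hj
  have hj0 : (0 : ℝ) < (j : ℝ) + 1 := by positivity
  have h1 : ((j : ℝ) + 1) ^ γ ≤ L / 4 * (j + 1) := by
    have : ((j : ℝ) + 1) ^ γ = ((j : ℝ) + 1) ^ (-(1 - γ)) * (j + 1) := by
      nth_rewrite 3 [← Real.rpow_one ((j : ℝ) + 1)]
      rw [← Real.rpow_add hj0]; ring_nf
    rw [this]; gcongr
  have h2 : ρ ^ (j + 1) = Real.exp (-L * (j + 1)) := by
    rw [hL, neg_neg, mul_comm]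
    have := Real.exp_nat_mul (Real.log ρ) (j + 1)
    rw [Real.exp_log hρ.1] at this
    rw [← this]; push_cast; rfl
  have h3 : ρ ^ (j + 1) * Real.exp (2 * ((j : ℝ) + 1) ^ γ) ≤ Real.exp (-L / 2) ^ j := by
    rw [h2, ← Real.exp_add, ← Real.exp_nat_mul, Real.exp_le_exp]
    nlinarith
  rw [Real.norm_of_nonneg (mul_nonneg (pow_nonneg hρ.1.le _) (Real.exp_pos _).le)]
  exact h3

/-- Borel–Cantelli bounds the j-th digit by (j+1)^{1+δ} for large j. Since (1+δ)(1-δ) < 1, the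
exponential of its power 1-δ is still beaten by ρ^j. -/
lemma ae_tailSum_lt_top {ρ δ : ℝ} (hρ : ρ ∈ Set.Ioo (0 : ℝ) 1) (hδ : δ ∈ Set.Ioo (0 : ℝ) 1) :
    ∀ᵐ x : ℝ, x ∈ unitIrr → tailSum ρ (1 - δ) x < ⊤ := by
  have hδ0 := hδ.1
  have hδ1 := hδ.2
  let a : ℕ → ℝ := fun j => ((j : ℝ) + 1) ^ (-(1 + δ))
  have ha0 : ∀ j, 0 ≤ a j := fun j => by positivity
  have ha : Summable a := by
    have := (summable_nat_add_iff 1).2 (Real.summable_nat_rpow (p := -(1 + δ)).2 (by linarith))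
    simpa [a] using this
  have hbc := ae_eventually_notMem (μ := (volume : Measure ℝ))
    (s := fun j => {x | x ∈ unitIrr ∧ gaussMap^[j] x ∈ Set.Ioo 0 (a j)}) (by
      refine ne_top_of_le_ne_top (ha.mul_left 4).tsum_ofReal_ne_top (ENNReal.tsum_le_tsum fun j => ?_)
      refine (volume_iterate_preimage_le _ j).trans ?_
      rw [Real.volume_Ioo, sub_zero, ENNReal.ofReal_mul (by norm_num)]
      norm_num)
  filter_upwards [hbc] with x hx hxI
  refine lt_top_iff_ne_top.2 (Summable.tsum_ofReal_ne_top ?_)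
  refine Summable.of_norm_bounded_eventually_nat
    (summable_pow_mul_exp_rpow hρ (γ := (1 + δ) * (1 - δ)) (by nlinarith)) ?_
  filter_upwards [hx] with j hj
  rw [Real.norm_of_nonneg (mul_nonneg (pow_nonneg hρ.1.le _) (Real.exp_pos _).le)]
  have hT := (iterate_gaussMap_mem hxI j).1.1
  have hj' : a j ≤ gaussMap^[j] x := by
    by_contra! hlt
    exact hj ⟨hxI, hT, hlt⟩
  have hj0 : (0 : ℝ) < (j : ℝ) + 1 := by positivity
  have hone : (1 : ℝ) ≤ ((j : ℝ) + 1) ^ (1 + δ) :=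
    Real.one_le_rpow (by linarith [Nat.cast_nonneg (α := ℝ) j]) (by linarith)
  have hd : (digit x j : ℝ) ≤ ((j : ℝ) + 1) ^ (1 + δ) := by
    calc (digit x j : ℝ) ≤ (gaussMap^[j] x)⁻¹ := Nat.floor_le (inv_nonneg.2 hT.le)
      _ ≤ (a j)⁻¹ := inv_anti₀ (by positivity) hj'
      _ = _ := by simp only [a]; rw [Real.rpow_neg hj0.le, inv_inv]
  have hρ0 := hρ.1
  gcongr
  calc ((digit x j : ℝ) + 1) ^ (1 - δ) ≤ (2 * ((j : ℝ) + 1) ^ (1 + δ)) ^ (1 - δ) :=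
        Real.rpow_le_rpow (by positivity) (by linarith) (by linarith)
    _ = 2 ^ (1 - δ) * ((j : ℝ) + 1) ^ ((1 + δ) * (1 - δ)) := by
        rw [Real.mul_rpow (by norm_num) (by positivity), ← Real.rpow_mul hj0.le]
    _ ≤ 2 * ((j : ℝ) + 1) ^ ((1 + δ) * (1 - δ)) := by
        gcongr
        calc (2 : ℝ) ^ (1 - δ) ≤ 2 ^ (1 : ℝ) :=
              Real.rpow_le_rpow_of_exponent_le (by norm_num) (by linarith)
          _ = 2 := Real.rpow_one _

lemma exists_volume_tailSum_gt_le {ρ δ : ℝ} (hρ : ρ ∈ Set.Ioo (0 : ℝ) 1)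
    (hδ : δ ∈ Set.Ioo (0 : ℝ) 1) {η : ℝ} (hη : 0 < η) :
    ∃ K : ℕ, volume {x | x ∈ unitIrr ∧ (K : ENNReal) < tailSum ρ (1 - δ) x} ≤
      ENNReal.ofReal η := by
  let s : ℕ → Set ℝ := fun K => {x | x ∈ unitIrr ∧ (K : ENNReal) < tailSum ρ (1 - δ) x}
  have hs : ∀ K, MeasurableSet (s K) := fun K =>
    measurableSet_unitIrr.inter (measurableSet_lt measurable_const (measurable_tailSum _ _))
  have hanti : Antitone s := fun m n hmn x hx =>
    ⟨hx.1, lt_of_le_of_lt (by exact_mod_cast hmn) hx.2⟩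
  have hfin : volume (s 0) ≠ ⊤ := by
    refine ne_top_of_le_ne_top ENNReal.one_ne_top ?_
    rw [← volume_unitIrr]
    exact measure_mono fun x hx => hx.1
  have hzero : volume (⋂ K, s K) = 0 := by
    refine measure_mono_null (fun x hx => ?_) (ae_tailSum_lt_top hρ hδ)
    rw [Set.mem_iInter] at hx
    refine fun hcon => ?_
    obtain ⟨K, hK⟩ := ENNReal.exists_nat_gt (hcon (hx 0).1).ne
    exact absurd (hx K).2 (not_lt.2 hK.le)
  have ht := tendsto_measure_iInter_atTop (μ := volume)
    (fun K => (hs K).nullMeasurableSet) hanti ⟨0, hfin⟩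
  rw [hzero] at ht
  obtain ⟨K, hK⟩ := (ht.eventually (gt_mem_nhds (ENNReal.ofReal_pos.2 hη))).exists
  exact ⟨K, hK.le⟩

/-! ### The series for the limit function -/

/-- The alternating sum `∑ (-1)^i b_i` of the digits of a word. -/
def altSum : List ℕ → ℤ
  | [] => 0
  | b :: v => altSum v + (-1) ^ (v.length + 1) * b

/-- The exponent of `ϑ` in the summand attached to a word. -/
def twist (v : List ℕ) : ℤ := -altSum v - (if Odd v.length then 3 else 0)

/-- The sign of the argument of `h` in the summand attached to a word. -/
def side (v : List ℕ) : ℝ := (-1) ^ (v.length + 1)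

/-- The summand attached to a word. -/
def term (k ϑ : ℂ) (h : ℝ → ℂ) (v : List ℕ) : ℂ :=
  ϑ ^ twist v * (den v : ℂ) ^ (-k) * h (side v * ratio v)

/-- The partial sum attached to a word, with initial value `c`. -/
def psum (k ϑ : ℂ) (h : ℝ → ℂ) (c : ℂ) : List ℕ → ℂ
  | [] => c
  | b :: v => psum k ϑ h c v + term k ϑ h (b :: v)

lemma side_of_odd {v : List ℕ} (hv : Odd v.length) : side v = 1 := hv.add_one.neg_one_pow

lemma side_of_even {v : List ℕ} (hv : Even v.length) : side v = -1 := hv.add_one.neg_one_pow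

lemma abs_side (v : List ℕ) : |side v| = 1 := by simp [side, abs_pow]

section Relations

variable {k ϑ : ℂ} {f : ℚ → ℂ} {h : ℝ → ℂ}

lemma IsTwistedQMF.apply_natCast_add (hf : IsTwistedQMF k ϑ f h) {y : ℚ} (hy : 0 < y)
    (b : ℕ) : f (b + y) = ϑ ^ b * f y := by
  induction b with
  | zero => simp
  | succ b ih =>
    have := hf.period (b + y) (fun hm => by
      have := hm.2
      have : (0 : ℚ) ≤ b := by positivity
      linarith)
    rw [show ((b + 1 : ℕ) : ℚ) + y = b + y + 1 by push_cast; ring, this, ih]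
    ring

/-- Every shift starts from a point below -1, hence outside the interval [-1, 0] where periodicity
is not assumed. -/
lemma IsTwistedQMF.apply_neg_natCast_sub (hf : IsTwistedQMF k ϑ f h) {y : ℚ} (hy : 0 < y)
    (b : ℕ) : f (-y) = ϑ ^ b * f (-(b + y)) := by
  induction b with
  | zero => simp
  | succ b ih =>
    have := hf.period (-((b + 1 : ℕ) + y)) (fun hm => by
      have := hm.1
      have : (0 : ℚ) ≤ b := by positivity
      push_cast at *
      linarith)
    rw [show -(((b + 1 : ℕ) : ℚ) + y) + 1 = -(b + y) by push_cast; ring] at this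
    rw [ih, this]
    ring

/-- The automorphy factor turns q_r^{-k} into q_{r-1}^{-k}, which makes the recursion telescope. -/
lemma den_cpow_mul_ratio_cpow {b : ℕ} {v : List ℕ} (hv : PosWord (b :: v)) :
    (den (b :: v) : ℂ) ^ (-k) * ((|ratio (b :: v)| : ℚ) : ℂ) ^ (-k) = (den v : ℂ) ^ (-k) := by
  have hd : (den (b :: v) : ℝ) ≠ 0 := by exact_mod_cast (den_pos hv).ne'
  rw [abs_of_nonneg (ratio_nonneg _)]
  have := Complex.mul_cpow_ofReal_nonneg (a := den (b :: v)) (b := (ratio (b :: v) : ℝ))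
    (by positivity) (by exact_mod_cast ratio_nonneg _) (-k)
  push_cast at this
  rw [← this]
  congr 1
  have h2 : (den (b :: v) : ℂ) ≠ 0 := by exact_mod_cast hd
  rw [ratio, Rat.cast_div, Rat.cast_natCast, Rat.cast_natCast, den'_cons]
  field_simp

/-- Reciprocity sends ratio(b::v) to -(b + ratio v), and conversely with signs exchanged;
periodicity then removes b. The sign thus alternates with the length, so odd and even words are
treated in one induction. -/
lemma IsTwistedQMF.psum_eq (hf : IsTwistedQMF k ϑ f h) (hϑ : ϑ ≠ 0) {v : List ℕ}
    (hv : PosWord v) (hne : v ≠ []) :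
    (Odd v.length → ϑ ^ (-(3 + altSum v)) * (den v : ℂ) ^ (-k) * f (ratio v) =
      psum k ϑ h (ϑ * f (-1)) v) ∧
    (Even v.length → ϑ ^ (-altSum v) * (den v : ℂ) ^ (-k) * f (-ratio v) =
      psum k ϑ h (ϑ * f (-1)) v) := by
  induction v with
  | nil => exact absurd rfl hne
  | cons b v ih =>
    have hpos : 0 < ratio (b :: v) := ratio_pos hv hne
    have hcpow := den_cpow_mul_ratio_cpow (k := k) hv
    rw [posWord_cons] at hv
    have hinv : 1 / ratio (b :: v) = b + ratio v := by rw [ratio_cons hv.2]; simp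
    have hlen : (b :: v).length = v.length + 1 := rfl
    constructor
    · intro hodd
      have heven : Even v.length := by
        rw [hlen] at hodd; simpa [Nat.odd_add_one] using hodd
      have hrec := hf.recip_pos _ hpos
      rw [show -1 / ratio (b :: v) = -(1 / ratio (b :: v)) by ring, hinv] at hrec
      have hval : ϑ ^ (-(altSum v) + (b : ℤ)) * (den v : ℂ) ^ (-k) * f (-(b + ratio v)) =
          psum k ϑ h (ϑ * f (-1)) v := by
        -- At the oldest digit the argument is -b, and shifting must stop at -1 after b - 1 steps;
        -- this is the origin of the initial value ϑ f(-1).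
        by_cases hv0 : v = []
        · subst hv0
          have h1 := hf.apply_neg_natCast_sub one_pos (b - 1)
          have h2 : (((b - 1 : ℕ) : ℚ) + 1) = b := by
            have := hv.1; rw [Nat.cast_sub this]; simp
          rw [h2] at h1
          simp only [altSum, den_nil, psum, ratio, den'_nil]
          rw [h1]
          have hb : ϑ * ϑ ^ (b - 1) = ϑ ^ b := by
            rw [← pow_succ', Nat.sub_add_cancel hv.1]
          simp [← mul_assoc, hb]
        · rw [← (ih hv.2 hv0).2 heven, hf.apply_neg_natCast_sub (ratio_pos hv.2 hv0) b,
            zpow_add₀ hϑ, zpow_natCast]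
          ring
      have hff : f (ratio (b :: v)) = h (ratio (b :: v)) + ϑ ^ (3 : ℤ) *
          ((|ratio (b :: v)| : ℚ) : ℂ) ^ (-k) * f (-(b + ratio v)) := by
        rw [hrec]; ring
      rw [psum, ← hval, hff, term, side_of_odd hodd, one_mul, ← hcpow]
      have e1 : twist (b :: v) = -(3 + altSum (b :: v)) := by
        rw [twist, if_pos hodd]; ring
      have e2 : -altSum v + (b : ℤ) = -(3 + altSum (b :: v)) + 3 := by
        rw [altSum, heven.add_one.neg_one_pow]; ring
      rw [e1, e2, zpow_add₀ hϑ]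
      ring
    · intro heven
      have hodd : Odd v.length := by
        rw [hlen] at heven; simpa [Nat.even_add_one] using heven
      have hv0 : v ≠ [] := by rintro rfl; simp at hodd
      have hrec := hf.recip_neg _ (neg_neg_of_pos hpos)
      rw [abs_neg, show -1 / -ratio (b :: v) = 1 / ratio (b :: v) by rw [neg_div_neg_eq], hinv,
        hf.apply_natCast_add (ratio_pos hv.2 hv0)] at hrec
      have hval := (ih hv.2 hv0).1 hodd
      have hff : f (-ratio (b :: v)) = h (-ratio (b :: v)) + ϑ ^ (-3 : ℤ) *
          ((|ratio (b :: v)| : ℚ) : ℂ) ^ (-k) * (ϑ ^ b * f (ratio v)) := by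
        push_cast at hrec
        rw [hrec]; ring
      rw [psum, ← hval, hff, term, side_of_even heven, ← hcpow]
      have e1 : twist (b :: v) = -altSum (b :: v) := by
        rw [twist, if_neg (Nat.not_odd_iff_even.2 heven)]; ring
      have e2 : -(3 + altSum v) = -altSum (b :: v) + -3 + b := by
        rw [altSum, hodd.add_one.neg_one_pow]; ring
      rw [e1, e2, zpow_add₀ hϑ, zpow_add₀ hϑ, zpow_natCast, neg_one_mul]
      ring

lemma partialQuotient_succ_eq {x : ℝ} (hx : x ∈ unitIrr) (n : ℕ) :
    partialQuotient x (n + 1) = digit x n := by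
  induction n generalizing x with
  | zero =>
    have h1 : Int.fract x = x := Int.fract_eq_self.2 ⟨hx.1.1.le, hx.1.2⟩
    simp only [partialQuotient, digit, Function.iterate_zero, id, h1]
    exact (Int.natCast_floor_eq_floor (inv_nonneg.2 hx.1.1.le)).symm
  | succ n ih =>
    have h1 : Int.fract x = x := Int.fract_eq_self.2 ⟨hx.1.1.le, hx.1.2⟩
    rw [digit_succ, ← ih (gaussMap_mem hx)]
    simp [partialQuotient, gaussMap, h1]

lemma twistExponent_eq {x : ℝ} (hx : x ∈ unitIrr) (n : ℕ) :
    twistExponent x n = 3 + altSum (word x n) := by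
  unfold twistExponent
  congr 1
  induction n with
  | zero => simp [altSum]
  | succ n ih =>
    rw [Finset.sum_Icc_succ_top (by omega), ih, word_succ, altSum, length_word,
      partialQuotient_succ_eq hx]

lemma IsTwistedQMF.daggerApprox_eq (hf : IsTwistedQMF k ϑ f h) (hϑ : ϑ ≠ 0) {x : ℝ}
    (hx : x ∈ unitIrr) (j : ℕ) :
    daggerApprox k ϑ f x j = psum k ϑ h (ϑ * f (-1)) (word x (2 * j + 1)) := by
  have hodd : Odd (2 * j + 1) := ⟨j, rfl⟩
  rw [← (hf.psum_eq hϑ (posWord_word hx _) (by simp)).1 (by simp), daggerApprox,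
    twistExponent_eq hx, convergent_den hx, modInv_convergent hx hodd]

end Relations

/-! ### Convergence -/

/-- The growth condition on the period function. -/
def Growth (h : ℝ → ℂ) (C δ : ℝ) : Prop :=
  ∀ x : ℝ, x ≠ 0 → |x| ≤ 1 → ‖h x‖ ≤ C * Real.exp (|x| ^ (-1 + δ))

lemma Growth.nonneg {h : ℝ → ℂ} {C δ : ℝ} (hh : Growth h C δ) : 0 ≤ C := by
  have := (norm_nonneg _).trans (hh 1 one_ne_zero (by simp))
  exact nonneg_of_mul_nonneg_left this (Real.exp_pos _)

section Convergence

variable {k ϑ c : ℂ} {f : ℚ → ℂ} {h : ℝ → ℂ} {C δ : ℝ}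

lemma norm_den_cpow {v : List ℕ} (hv : PosWord v) :
    ‖(den v : ℂ) ^ (-k)‖ = (den v : ℝ) ^ (-k.re) := by
  rw [Complex.norm_natCast_cpow_of_pos (den_pos hv), Complex.neg_re]

lemma abs_side_mul_ratio (v : List ℕ) : |side v * (ratio v : ℝ)| = ratio v := by
  rw [abs_mul, abs_side, one_mul, abs_of_nonneg]
  exact_mod_cast ratio_nonneg v

lemma norm_term_le (hϑ : ‖ϑ‖ = 1) {v : List ℕ} (hv : PosWord v) :
    ‖term k ϑ h v‖ = (den v : ℝ) ^ (-k.re) * ‖h (side v * ratio v)‖ := by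
  rw [term, norm_mul, norm_mul, norm_zpow, hϑ, one_zpow, one_mul, norm_den_cpow hv]

/-- The argument has modulus 1/(b + ratio v) ≥ 1/(b + 1). -/
lemma Growth.norm_apply_le (hh : Growth h C δ) (hδ : δ < 1) {b : ℕ} {v : List ℕ}
    (hv : PosWord (b :: v)) :
    ‖h (side (b :: v) * ratio (b :: v))‖ ≤ C * Real.exp (((b : ℝ) + 1) ^ (1 - δ)) := by
  have hr : (0 : ℝ) < ratio (b :: v) := by exact_mod_cast ratio_pos hv (by simp)
  have hr1 : (ratio (b :: v) : ℝ) ≤ 1 := by exact_mod_cast ratio_le_one hv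
  have habs := abs_side_mul_ratio (b :: v)
  refine (hh _ (fun h0 => ?_) (by rwa [habs])).trans ?_
  · rw [h0, abs_zero] at habs; exact hr.ne habs
  have := hh.nonneg
  rw [habs]
  gcongr
  have hv' := (posWord_cons.1 hv).2
  have h1 : (ratio v : ℝ) ≤ 1 := by exact_mod_cast ratio_le_one hv'
  have h0 : (0 : ℝ) ≤ ratio v := by exact_mod_cast ratio_nonneg v
  rw [ratio_cons hv']
  push_cast
  rw [one_div, Real.inv_rpow (by positivity), ← Real.rpow_neg (by positivity),
    show -(-1 + δ) = 1 - δ by ring]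
  gcongr

/-- The bound separates: the older word u enters only through q(u)^{-Re k}, and the rest is a
summand of `tailSum` at t. This makes the remainder estimate uniform in u. -/
lemma Growth.norm_term_le (hh : Growth h C δ) (hδ : δ < 1) (hk : 0 < k.re) (hϑ : ‖ϑ‖ = 1)
    {u : List ℕ} (hu : PosWord u) {t : ℝ} (ht : t ∈ unitIrr) (j : ℕ) :
    ‖term k ϑ h (word t (j + 1) ++ u)‖ ≤ C * (3 / 2) ^ k.re * (den u : ℝ) ^ (-k.re) *
      (((2 / 3 : ℝ) ^ k.re) ^ (j + 1) * Real.exp (((digit t j : ℝ) + 1) ^ (1 - δ))) := by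
  have hw := posWord_word ht (j + 1)
  have hp : PosWord (word t (j + 1) ++ u) := posWord_append.2 ⟨hw, hu⟩
  have hdu : (0 : ℝ) < den u := by exact_mod_cast den_pos hu
  have hge := den_append_ge hw hu
  rw [length_word] at hge
  have h1 : (den (word t (j + 1) ++ u) : ℝ) ^ (-k.re) ≤
      (3 / 2) ^ k.re * ((2 / 3 : ℝ) ^ k.re) ^ (j + 1) * (den u : ℝ) ^ (-k.re) := by
    refine (Real.rpow_le_rpow_of_nonpos (by positivity) hge (by linarith)).trans (le_of_eq ?_)
    rw [Real.mul_rpow (by positivity) hdu.le, Real.mul_rpow (by norm_num) (by positivity),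
      Real.rpow_neg (by norm_num), ← Real.inv_rpow (by norm_num), Real.rpow_neg (by positivity),
      ← Real.inv_rpow (by positivity), ← inv_pow,
      Real.rpow_pow_comm (by norm_num) k.re]
    norm_num
  have h2 := hh.norm_apply_le hδ (b := digit t j) (v := word t j ++ u) (by simpa using hp)
  rw [QMF.norm_term_le hϑ hp]
  calc _ ≤ ((3 / 2) ^ k.re * ((2 / 3 : ℝ) ^ k.re) ^ (j + 1) * (den u : ℝ) ^ (-k.re)) *
        (C * Real.exp (((digit t j : ℝ) + 1) ^ (1 - δ))) := by
        gcongr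
        exact h2
    _ = _ := by ring

lemma psum_word_append (u : List ℕ) (t : ℝ) (n : ℕ) :
    psum k ϑ h c (word t n ++ u) = psum k ϑ h c u +
      ∑ j ∈ Finset.range n, term k ϑ h (word t (j + 1) ++ u) := by
  induction n with
  | zero => simp
  | succ n ih =>
    rw [Finset.sum_range_succ, ← add_assoc, ← ih]
    rfl

lemma Growth.tendsto_psum (hh : Growth h C δ) (hδ : δ < 1) (hk : 0 < k.re) (hϑ : ‖ϑ‖ = 1)
    {u : List ℕ} (hu : PosWord u) {t : ℝ} (ht : t ∈ unitIrr)
    (hfin : tailSum ((2 / 3 : ℝ) ^ k.re) (1 - δ) t < ⊤) :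
    ∃ L : ℂ, Tendsto (fun n => psum k ϑ h c (word (mobius u t) n)) atTop (𝓝 L) ∧
      ‖L - psum k ϑ h c u‖ ≤ C * (3 / 2) ^ k.re * (den u : ℝ) ^ (-k.re) *
        (tailSum ((2 / 3 : ℝ) ^ k.re) (1 - δ) t).toReal := by
  set D := C * (3 / 2) ^ k.re * (den u : ℝ) ^ (-k.re) with hD
  set a : ℕ → ℝ := fun j => ((2 / 3 : ℝ) ^ k.re) ^ (j + 1) *
    Real.exp (((digit t j : ℝ) + 1) ^ (1 - δ)) with ha
  have ha0 : ∀ j, 0 ≤ a j := fun j => by positivity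
  have hsum : Summable a := by
    have := ENNReal.summable_toReal hfin.ne
    exact this.congr fun j => ENNReal.toReal_ofReal (ha0 j)
  have htsum : (tailSum ((2 / 3 : ℝ) ^ k.re) (1 - δ) t).toReal = ∑' j, a j := by
    rw [tailSum, ← ENNReal.ofReal_tsum_of_nonneg ha0 hsum,
      ENNReal.toReal_ofReal (tsum_nonneg ha0)]
  have hbound : ∀ j, ‖term k ϑ h (word t (j + 1) ++ u)‖ ≤ D * a j :=
    fun j => hh.norm_term_le hδ hk hϑ hu ht j
  have hterm : Summable fun j => term k ϑ h (word t (j + 1) ++ u) :=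
    Summable.of_norm_bounded (hsum.mul_left D) hbound
  refine ⟨psum k ϑ h c u + ∑' j, term k ϑ h (word t (j + 1) ++ u), ?_, ?_⟩
  · rw [← tendsto_add_atTop_iff_nat u.length]
    refine (hterm.hasSum.tendsto_sum_nat.const_add (psum k ϑ h c u)).congr fun n => ?_
    rw [add_comm n, word_mobius_add hu ht, psum_word_append]
  · rw [add_sub_cancel_left, htsum, ← tsum_mul_left]
    exact tsum_of_norm_bounded (hsum.mul_left D).hasSum hbound

lemma Growth.tendsto_daggerApprox (hf : IsTwistedQMF k ϑ f h) (hh : Growth h C δ) (hδ : δ < 1)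
    (hk : 0 < k.re) (hϑ : ‖ϑ‖ = 1) {u : List ℕ} (hu : PosWord u) {t : ℝ} (ht : t ∈ unitIrr)
    (hfin : tailSum ((2 / 3 : ℝ) ^ k.re) (1 - δ) t < ⊤) :
    Tendsto (daggerApprox k ϑ f (mobius u t)) atTop (𝓝 (fDagger k ϑ f (mobius u t))) ∧
      ‖fDagger k ϑ f (mobius u t) - psum k ϑ h (ϑ * f (-1)) u‖ ≤
        C * (3 / 2) ^ k.re * (den u : ℝ) ^ (-k.re) *
          (tailSum ((2 / 3 : ℝ) ^ k.re) (1 - δ) t).toReal := by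
  have hϑ0 : ϑ ≠ 0 := fun h0 => by simp [h0] at hϑ
  obtain ⟨L, hL, hb⟩ := hh.tendsto_psum (c := ϑ * f (-1)) hδ hk hϑ hu ht hfin
  have hlim : Tendsto (daggerApprox k ϑ f (mobius u t)) atTop (𝓝 L) := by
    have hodd : Tendsto (fun j : ℕ => 2 * j + 1) atTop atTop :=
      tendsto_atTop_mono (fun j => by simp only [id]; omega) tendsto_id
    refine (hL.comp hodd).congr fun j => ?_
    rw [hf.daggerApprox_eq hϑ0 (mobius_spec hu ht).1]; rfl
  have hval : fDagger k ϑ f (mobius u t) = L := hlim.limUnder_eq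
  rw [hval]
  exact ⟨hlim, hb⟩

/-- The points of the unit interval at which the majorant is finite. -/
def goodSet (k : ℂ) (δ : ℝ) : Set ℝ :=
  {x | x ∈ unitIrr ∧ tailSum ((2 / 3 : ℝ) ^ k.re) (1 - δ) x < ⊤}

lemma measurableSet_goodSet (k : ℂ) (δ : ℝ) : MeasurableSet (goodSet k δ) :=
  measurableSet_unitIrr.inter (measurableSet_lt (measurable_tailSum _ _) measurable_const)

lemma rpow_two_thirds_mem (hk : 0 < k.re) : (2 / 3 : ℝ) ^ k.re ∈ Set.Ioo (0 : ℝ) 1 :=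
  ⟨by positivity, Real.rpow_lt_one (by norm_num) (by norm_num) hk⟩

lemma ae_mem_goodSet (hk : 0 < k.re) (hδ : δ ∈ Set.Ioo (0 : ℝ) 1) :
    ∀ᵐ x ∂(volume.restrict (Set.Icc (0 : ℝ) 1)), x ∈ goodSet k δ := by
  filter_upwards [ae_mem_unitIrr,
    ae_restrict_of_ae (ae_tailSum_lt_top (rpow_two_thirds_mem hk) hδ)] with x h1 h2
  exact ⟨h1, h2 h1⟩

lemma measurable_word (n : ℕ) (g : List ℕ → ℂ) : Measurable fun x => g (word x n) := by
  -- There are countably many words, so it suffices to treat preimages of single words.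
  let _ : MeasurableSpace (List ℕ) := ⊤
  have : Measurable fun x => word x n := by
    refine measurable_to_countable' fun v => ?_
    induction n generalizing v with
    | zero => exact measurable_const (measurableSet_singleton v)
    | succ n ih =>
      cases v with
      | nil =>
        have : (fun x => word x (n + 1)) ⁻¹' {[]} = ∅ := by ext x; simp
        rw [this]
        exact MeasurableSet.empty
      | cons b v =>
        have : (fun x => word x (n + 1)) ⁻¹' {b :: v} =
            (fun x => digit x n) ⁻¹' {b} ∩ (fun x => word x n) ⁻¹' {v} := by
          ext x; simp
        rw [this]
        exact (measurable_digit n (measurableSet_singleton b)).inter (ih v)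
  exact (measurable_from_top (f := g)).comp this

/-- Off `goodSet` the limit may be a default value; on it, the function is a pointwise limit of
functions of finitely many digits. -/
lemma Growth.measurable_indicator_fDagger (hf : IsTwistedQMF k ϑ f h) (hh : Growth h C δ)
    (hδ : δ < 1) (hk : 0 < k.re) (hϑ : ‖ϑ‖ = 1) :
    Measurable ((goodSet k δ).indicator (fDagger k ϑ f)) := by
  have hϑ0 : ϑ ≠ 0 := fun h0 => by simp [h0] at hϑ
  refine measurable_of_tendsto_metrizable (f := fun j => (goodSet k δ).indicator
    fun x => psum k ϑ h (ϑ * f (-1)) (word x (2 * j + 1)))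
    (fun j => (measurable_word _ _).indicator (measurableSet_goodSet k δ)) ?_
  rw [tendsto_pi_nhds]
  intro x
  by_cases hx : x ∈ goodSet k δ
  · simp only [Set.indicator_of_mem hx]
    have := (hh.tendsto_daggerApprox hf hδ hk hϑ posWord_nil hx.1 hx.2).1
    rw [mobius_nil] at this
    exact this.congr fun j => hf.daggerApprox_eq hϑ0 hx.1 j
  · simp [Set.indicator_of_notMem hx]

lemma Growth.aemeasurable_fDagger (hf : IsTwistedQMF k ϑ f h) (hh : Growth h C δ)
    (hδ : δ ∈ Set.Ioo (0 : ℝ) 1) (hk : 0 < k.re) (hϑ : ‖ϑ‖ = 1) :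
    AEMeasurable (fDagger k ϑ f) (volume.restrict (Set.Icc (0 : ℝ) 1)) := by
  refine ⟨_, hh.measurable_indicator_fDagger hf hδ.2 hk hϑ, ?_⟩
  filter_upwards [ae_mem_goodSet hk hδ] with x hx
  rw [Set.indicator_of_mem hx]

/-- If a level set of `φ ∘ f†` has positive measure, then along some point all the partial sums
are close to the level. -/
lemma Growth.exists_point_of_level_set (φ : ℂ →ₗ[ℝ] ℝ) (hf : IsTwistedQMF k ϑ f h)
    (hh : Growth h C δ) (hδ : δ ∈ Set.Ioo (0 : ℝ) 1) (hk : 0 < k.re) (hϑ : ‖ϑ‖ = 1) {r : ℝ}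
    (hpos : volume {x | x ∈ goodSet k δ ∧ φ (fDagger k ϑ f x) = r} ≠ 0) :
    ∃ x ∈ unitIrr, ∃ K : ℝ, 0 ≤ K ∧ ∀ w, PosWord w → ∀ᶠ n in atTop,
      |φ (psum k ϑ h (ϑ * f (-1)) (w ++ word x n)) - r| ≤
        K * (den (w ++ word x n) : ℝ) ^ (-k.re) := by
  set E := {x | x ∈ goodSet k δ ∧ φ (fDagger k ϑ f x) = r} with hE
  have hφ : Continuous φ := φ.continuous_of_finiteDimensional
  have hEm : MeasurableSet E := by
    have : E = goodSet k δ ∩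
        (fun x => φ ((goodSet k δ).indicator (fDagger k ϑ f) x)) ⁻¹' {r} := by
      ext x
      refine and_congr_right fun hx => ?_
      simp [Set.indicator_of_mem hx]
    rw [this]
    exact (measurableSet_goodSet k δ).inter ((hφ.measurable.comp
      (hh.measurable_indicator_fDagger hf hδ.2 hk hϑ)) (measurableSet_singleton r))
  -- The points with majorant above K form the exceptional set of tails for `exists_density_point`,
  -- which allows measure 1/16.
  obtain ⟨K, hK⟩ := exists_volume_tailSum_gt_le (rpow_two_thirds_mem hk) hδ
    (η := 1 / 16) (by norm_num)
  obtain ⟨x, hxE, hx⟩ := exists_density_point hEm (fun x hx => hx.1.1) hpos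
    (fun x hx => hx.1) hK
  have hC := hh.nonneg
  obtain ⟨M, hM0, hM⟩ : ∃ M : ℝ, 0 ≤ M ∧ ∀ z, |φ z| ≤ M * ‖z‖ :=
    ⟨‖φ.toContinuousLinearMap‖, norm_nonneg _, fun z => φ.toContinuousLinearMap.le_opNorm z⟩
  refine ⟨x, hxE.1.1, M * (C * (3 / 2) ^ k.re * K), by positivity, fun w hw => ?_⟩
  filter_upwards [hx w hw] with n hn
  obtain ⟨t, ht, htE⟩ := hn
  have hp : PosWord (w ++ word x n) := posWord_append.2 ⟨hw, posWord_word hxE.1.1 n⟩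
  have htK : tailSum ((2 / 3 : ℝ) ^ k.re) (1 - δ) t ≤ K := by
    by_contra! hlt
    exact ht.2 ⟨ht.1, hlt⟩
  have hb := (hh.tendsto_daggerApprox hf hδ.2 hk hϑ hp ht.1
    (htK.trans_lt (ENNReal.natCast_lt_top K))).2
  have htK' : (tailSum ((2 / 3 : ℝ) ^ k.re) (1 - δ) t).toReal ≤ K := by
    simpa using ENNReal.toReal_mono (ENNReal.natCast_ne_top K) htK
  rw [← htE.2, ← map_sub, ← abs_neg, ← map_neg, neg_sub]
  calc _ ≤ M * ‖fDagger k ϑ f (mobius (w ++ word x n) t) -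
        psum k ϑ h (ϑ * f (-1)) (w ++ word x n)‖ := hM _
    _ ≤ M * (C * (3 / 2) ^ k.re * (den (w ++ word x n) : ℝ) ^ (-k.re) * K) := by
        gcongr
        exact hb.trans (by gcongr)
    _ = _ := by ring

end Convergence

/-- The jump of the distribution function at r is the mass of {r}. -/
lemma continuous_cdf_of_noAtoms (μ : Measure ℝ) [IsProbabilityMeasure μ]
    (h : ∀ r, μ {r} = 0) : Continuous (cdf μ) := by
  rw [continuous_iff_continuousAt]
  intro r
  rw [(monotone_cdf μ).continuousAt_iff_leftLim_eq_rightLim, (cdf μ).rightLim_eq]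
  have := (cdf μ).measure_singleton r
  rw [measure_cdf, h r] at this
  refine le_antisymm ((monotone_cdf μ).leftLim_le le_rfl) ?_
  have := ENNReal.ofReal_eq_zero.1 this.symm
  linarith

/-! ### Normalized summands -/

/-- The unimodular factor of the summand attached to a word. -/
def phase (k ϑ : ℂ) (v : List ℕ) : ℂ :=
  ϑ ^ twist v * Complex.exp ((-(k.im * Real.log (den v)) : ℝ) * Complex.I)

section Phase

variable {k ϑ : ℂ} {h : ℝ → ℂ}

lemma norm_phase (hϑ : ‖ϑ‖ = 1) (v : List ℕ) : ‖phase k ϑ v‖ = 1 := by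
  rw [phase, norm_mul, norm_zpow, hϑ, one_zpow, one_mul, Complex.norm_exp_ofReal_mul_I]

lemma zpow_mul_den_cpow {v : List ℕ} (hv : PosWord v) :
    ϑ ^ twist v * (den v : ℂ) ^ (-k) = ((den v : ℝ) ^ (-k.re) : ℝ) * phase k ϑ v := by
  have hd : (0 : ℝ) < den v := by exact_mod_cast den_pos hv
  have hd' : (den v : ℂ) ≠ 0 := by exact_mod_cast hd.ne'
  have : (den v : ℂ) ^ (-k) = ((den v : ℝ) ^ (-k.re) : ℝ) *
      Complex.exp ((-(k.im * Real.log (den v)) : ℝ) * Complex.I) := by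
    rw [Complex.cpow_def_of_ne_zero hd', Real.rpow_def_of_pos hd, Complex.ofReal_exp,
      ← Complex.exp_add, ← Complex.natCast_log]
    congr 1
    apply Complex.ext <;> simp <;> ring
  rw [this, phase]; ring

lemma map_term (φ : ℂ →ₗ[ℝ] ℝ) {v : List ℕ} (hv : PosWord v) :
    φ (term k ϑ h v) = (den v : ℝ) ^ (-k.re) * φ (phase k ϑ v * h (side v * ratio v)) := by
  rw [term, zpow_mul_den_cpow hv, mul_assoc, ← Complex.real_smul, map_smul, smul_eq_mul]

lemma zpow_eq_of_modEq {N : ℕ} (hN : ϑ ^ N = 1) (h0 : 0 < N) {a b : ℤ} (hab : a ≡ b [ZMOD N]) :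
    ϑ ^ a = ϑ ^ b := by
  have hϑ : ϑ ≠ 0 := by rintro rfl; simp [h0.ne'] at hN
  obtain ⟨c, hc⟩ := hab.dvd
  rw [show b = a + N * c by linarith, zpow_add₀ hϑ, zpow_mul, zpow_natCast, hN, one_zpow, mul_one]

lemma norm_eq_one_of_pow {N : ℕ} (hN : ϑ ^ N = 1) (h0 : 0 < N) : ‖ϑ‖ = 1 :=
  Complex.norm_eq_one_of_pow_eq_one hN h0.ne'

lemma altSum_append (l v : List ℕ) :
    altSum (l ++ v) = altSum v + (-1) ^ v.length * altSum l := by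
  induction l with
  | nil => simp [altSum]
  | cons b l ih =>
    rw [List.cons_append, altSum, ih, altSum, List.length_append]
    ring

/-- The exponent is affine in any single digit with slope ±1, so the residue of that digit modulo
the order of ϑ controls the power of ϑ. -/
lemma exists_twist_eq (l u : List ℕ) :
    ∃ c : ℤ, ∀ b : ℕ, twist (l ++ b :: u) = c + (-1) ^ u.length * b := by
  refine ⟨-(altSum u + (-1) ^ (u.length + 1) * altSum l) -
    (if Odd (l.length + (u.length + 1)) then 3 else 0), fun b => ?_⟩
  rw [twist, altSum_append, altSum, List.length_append, List.length_cons]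
  ring

lemma twist_modEq (l u : List ℕ) {N : ℕ} {a b : ℕ} (hab : (a : ℤ) ≡ b [ZMOD N]) :
    twist (l ++ a :: u) ≡ twist (l ++ b :: u) [ZMOD N] := by
  obtain ⟨c, hc⟩ := exists_twist_eq l u
  rw [hc, hc]
  exact (hab.mul_left _).add_left _

lemma exists_forall_twist_modEq (l u : List ℕ) (N : ℕ) (p : ℤ) :
    ∃ c : ℤ, ∀ b : ℕ, (b : ℤ) ≡ c [ZMOD N] → twist (l ++ b :: u) ≡ p [ZMOD N] := by
  obtain ⟨c, hc⟩ := exists_twist_eq l u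
  refine ⟨(-1) ^ u.length * (p - c), fun b hb => ?_⟩
  have h2 : ((-1 : ℤ) ^ u.length) * (-1) ^ u.length = 1 := by rw [← mul_pow]; simp
  rw [hc]
  have := (hb.mul_left ((-1) ^ u.length)).add_left c
  rwa [← mul_assoc, h2, one_mul, add_sub_cancel] at this

end Phase

/-! ### Choice of digits -/

lemma exists_digit_modEq {N : ℕ} (hN : 0 < N) (c : ℤ) :
    ∃ b : ℕ, 0 < b ∧ b ≤ N ∧ (b : ℤ) ≡ c [ZMOD N] := by
  have hN' : (0 : ℤ) < N := by exact_mod_cast hN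
  have h0 := Int.emod_nonneg (c - 1) hN'.ne'
  have h1 := Int.emod_lt_of_pos (c - 1) hN'
  refine ⟨((c - 1) % N + 1).toNat, by omega, by omega, ?_⟩
  rw [Int.toNat_of_nonneg (by omega)]
  have := (Int.mod_modEq (c - 1) N).add_right 1
  rwa [sub_add_cancel] at this

/-- Large digits in a residue class with prescribed approximate logarithm. -/
lemma exists_digit_log {N : ℕ} (hN : 0 < N) {η : ℝ} (hη : 0 < η) :
    ∃ L₀ : ℝ, ∀ L ≥ L₀, ∀ y ∈ Set.Icc (0 : ℝ) 1, ∀ c : ℤ,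
      ∃ b : ℕ, 0 < b ∧ (b : ℝ) ≤ Real.exp L ∧ (b : ℤ) ≡ c [ZMOD N] ∧
        |Real.log (b + y) - L| < η := by
  have h1 : 0 < 1 - Real.exp (-η) := by
    have := Real.exp_lt_one_iff.2 (neg_neg_of_pos hη); linarith
  have h2 : 0 < Real.exp η - 1 := by
    have := Real.one_lt_exp_iff.2 hη; linarith
  -- `t1` leaves room below e^L for the floor and a step back of up to N, `t2` leaves room above for
  -- y ≤ 1, and `t3` keeps the digit positive.
  have t1 := (Real.tendsto_exp_atTop.atTop_mul_const h1).eventually_gt_atTop ((N : ℝ) + 1)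
  have t2 := (Real.tendsto_exp_atTop.atTop_mul_const h2).eventually_gt_atTop 1
  have t3 := Real.tendsto_exp_atTop.eventually_gt_atTop ((N : ℝ) + 1)
  obtain ⟨L₀, hL₀⟩ := eventually_atTop.1 (t1.and (t2.and t3))
  refine ⟨L₀, fun L hL y hy c => ?_⟩
  obtain ⟨e1, e2, e3⟩ := hL₀ L hL
  have hN' : (0 : ℤ) < N := by exact_mod_cast hN
  set m : ℤ := ⌊Real.exp L⌋ with hm
  have hm1 : (m : ℝ) ≤ Real.exp L := Int.floor_le _
  have hm2 : Real.exp L < m + 1 := Int.lt_floor_add_one _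
  have hmN : (N : ℤ) < m := by
    have : (N : ℝ) < m := by linarith
    exact_mod_cast this
  have r0 := Int.emod_nonneg (m - c) hN'.ne'
  have r1 := Int.emod_lt_of_pos (m - c) hN'
  set b : ℤ := m - (m - c) % N with hb
  have hb0 : 0 < b := by omega
  obtain ⟨b', hb'⟩ := Int.eq_ofNat_of_zero_le hb0.le
  have hbR : (b' : ℝ) = b := by rw [hb']; simp
  have hbm : (b : ℝ) ≤ m := by exact_mod_cast (by omega : b ≤ m)
  have hbm' : (m : ℝ) ≤ b + N := by exact_mod_cast (by omega : m ≤ b + N)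
  have hpos : (0 : ℝ) < b' + y := by
    have : (0 : ℝ) < b := by exact_mod_cast hb0
    rw [hbR]; linarith [hy.1]
  refine ⟨b', by omega, by rw [hbR]; linarith, ?_, ?_⟩
  · have hmod := (Int.ModEq.refl m).sub (Int.mod_modEq (m - c) N)
    rw [sub_sub_cancel] at hmod
    rwa [← hb']
  · rw [abs_lt]
    constructor
    · have : Real.exp (L + -η) < b' + y := by
        rw [Real.exp_add, hbR]; linarith [hy.1]
      have := (Real.lt_log_iff_exp_lt hpos).2 this
      linarith
    · have : b' + y < Real.exp (L + η) := by
        rw [Real.exp_add, hbR]; linarith [hy.2]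
      have := (Real.log_lt_iff_lt_exp hpos).2 this
      linarith

lemma log_den_cons {b : ℕ} {u : List ℕ} (hb : 0 < b) (hu : PosWord u) :
    Real.log (den (b :: u)) = Real.log (den u) + Real.log (b + ratio u) := by
  have hd : (0 : ℝ) < den u := by exact_mod_cast den_pos hu
  have h0 : (0 : ℝ) ≤ ratio u := by exact_mod_cast ratio_nonneg u
  have hb' : (0 : ℝ) < b := by exact_mod_cast hb
  rw [← Real.log_mul hd.ne' (by positivity)]
  congr 1
  rw [den_cons, ratio]
  push_cast
  field_simp

lemma exists_digit_phase_real {k ϑ : ℂ} {N : ℕ} (hN : ϑ ^ N = 1) (h0 : 0 < N) (hk : k.im = 0)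
    (p : ℤ) (u : List ℕ) :
    ∃ c : ℤ, ∀ b : ℕ, (b : ℤ) ≡ c [ZMOD N] → phase k ϑ (b :: u) = ϑ ^ p := by
  obtain ⟨c, hc⟩ := exists_forall_twist_modEq [] u N p
  refine ⟨c, fun b hb => ?_⟩
  have hb' : twist (b :: u) ≡ p [ZMOD N] := hc b hb
  rw [phase, zpow_eq_of_modEq hN h0 hb', hk]
  simp

/-- Besides the power of ϑ, the angle is -Im k (log q(u) + log(b + ratio u)). Moving log(b + ratio
u) by 2π/|Im k| gives a full turn, so a window of that length, independent of u, contains an L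
giving angle 2πβ; a deviation from L shifts the angle linearly. -/
lemma exists_log_phase {k ϑ : ℂ} {N : ℕ} (hN : ϑ ^ N = 1) (h0 : 0 < N) (hk : k.im ≠ 0)
    (β : ℝ) (L₀ : ℝ) {u : List ℕ} (hu : PosWord u) :
    ∃ L ∈ Set.Icc L₀ (L₀ + 2 * Real.pi / |k.im|), ∀ b : ℕ, 0 < b → (b : ℤ) ≡ 0 [ZMOD N] →
      phase k ϑ (b :: u) = Complex.exp (2 * Real.pi * Complex.I *
        ((β - k.im * (Real.log (b + ratio u) - L) / (2 * Real.pi) : ℝ) : ℂ)) := by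
  have hτ : 0 < |k.im| := abs_pos.2 hk
  have hpi := Real.pi_pos
  obtain ⟨c, hc⟩ := exists_twist_eq [] u
  have hϑ := norm_eq_one_of_pow hN h0
  set χ : ℝ := Complex.arg (ϑ ^ c) - k.im * Real.log (den u) with hχ
  obtain ⟨m, hm, -⟩ := existsUnique_add_zsmul_mem_Ico (show 0 < 2 * Real.pi / |k.im| by positivity)
    ((χ - 2 * Real.pi * β) / k.im) L₀
  refine ⟨_, ⟨hm.1, hm.2.le⟩, fun b hb hbN => ?_⟩
  obtain ⟨j, hj⟩ : ∃ j : ℤ, k.im * ((χ - 2 * Real.pi * β) / k.im + m • (2 * Real.pi / |k.im|)) =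
      χ - 2 * Real.pi * β + 2 * Real.pi * j := by
    rcases lt_or_gt_of_ne hk with hneg | hpos
    · refine ⟨-m, ?_⟩
      rw [abs_of_neg hneg, zsmul_eq_mul]
      push_cast
      field_simp
    · refine ⟨m, ?_⟩
      rw [abs_of_pos hpos, zsmul_eq_mul]
      field_simp
  set L := (χ - 2 * Real.pi * β) / k.im + m • (2 * Real.pi / |k.im|)
  have hz : ϑ ^ twist (b :: u) = Complex.exp ((Complex.arg (ϑ ^ c) : ℝ) * Complex.I) := by
    have h1 : twist (b :: u) ≡ c [ZMOD N] := by
      have := (hbN.mul_left ((-1) ^ u.length)).add_left c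
      rw [mul_zero, add_zero] at this
      rw [← List.nil_append (b :: u), hc b]
      exact this
    rw [zpow_eq_of_modEq hN h0 h1]
    have := Complex.norm_mul_exp_arg_mul_I (ϑ ^ c)
    rw [norm_zpow, hϑ, one_zpow, Complex.ofReal_one, one_mul] at this
    exact this.symm
  rw [phase, hz, ← Complex.exp_add, Complex.exp_eq_exp_iff_exists_int]
  refine ⟨-j, ?_⟩
  rw [log_den_cons hb hu]
  have key : Complex.arg (ϑ ^ c) + -(k.im * (Real.log (den u) + Real.log (b + ratio u))) =
      2 * Real.pi * (β - k.im * (Real.log (b + ratio u) - L) / (2 * Real.pi)) +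
        -j * (2 * Real.pi) := by
    have : 2 * Real.pi * (β - k.im * (Real.log (b + ratio u) - L) / (2 * Real.pi)) =
        2 * Real.pi * β - k.im * Real.log (b + ratio u) + k.im * L := by
      field_simp; ring
    rw [this, hj, hχ]; ring
  have key' := congrArg (fun r : ℝ => (r : ℂ) * Complex.I) key
  push_cast at key' ⊢
  linear_combination key'

/-! ### Contradiction in the unbounded case -/

/-- All partial sums along the expansion of `x`, after prolongation by a fixed word, are close to
the level `r`. -/
def NearLevel (k ϑ : ℂ) (h : ℝ → ℂ) (c : ℂ) (φ : ℂ →ₗ[ℝ] ℝ) (r K x : ℝ) : Prop :=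
  ∀ w, PosWord w → ∀ᶠ n in atTop,
    |φ (psum k ϑ h c (w ++ word x n)) - r| ≤ K * (den (w ++ word x n) : ℝ) ^ (-k.re)

section Unbounded

variable {k ϑ c : ℂ} {h : ℝ → ℂ} {φ : ℂ →ₗ[ℝ] ℝ} {r K x : ℝ}

/-- Congruent digits give equal powers of ϑ and equal sides. As q_{r-1} is shared, the two ratios
differ exactly by the factor U = q_a/q_b, which produces the numerator of `relDiff`. -/
lemma term_sub_term {N : ℕ} (hN : ϑ ^ N = 1) (h0 : 0 < N) {a b : ℕ} {u : List ℕ}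
    (ha : 0 < a) (hb : 0 < b) (hu : PosWord u) (hab : (a : ℤ) ≡ b [ZMOD N]) :
    φ (term k ϑ h (a :: u)) - φ (term k ϑ h (b :: u)) =
      (den (a :: u) : ℝ) ^ (-k.re) * φ (phase k ϑ (a :: u) *
        (h (side (a :: u) * ratio (a :: u)) - (((den (a :: u) : ℝ) / den (b :: u) : ℝ) : ℂ) ^ k *
          h ((den (a :: u) : ℝ) / den (b :: u) * (side (a :: u) * ratio (a :: u))))) := by
  have hpa : PosWord (a :: u) := posWord_cons.2 ⟨ha, hu⟩
  have hpb : PosWord (b :: u) := posWord_cons.2 ⟨hb, hu⟩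
  have hda : (0 : ℝ) < den (a :: u) := by exact_mod_cast den_pos hpa
  have hdb : (0 : ℝ) < den (b :: u) := by exact_mod_cast den_pos hpb
  rw [← smul_eq_mul, ← map_smul, ← map_sub]
  congr 1
  rw [Complex.real_smul, ← mul_assoc, ← zpow_mul_den_cpow hpa, term, term]
  have e1 : ϑ ^ twist (b :: u) = ϑ ^ twist (a :: u) :=
    (zpow_eq_of_modEq hN h0 (twist_modEq [] u hab)).symm
  have e2 : side (b :: u) = side (a :: u) := rfl
  have e3 : (den (a :: u) : ℝ) / den (b :: u) * (side (a :: u) * ratio (a :: u)) =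
      side (a :: u) * ratio (b :: u) := by
    rw [ratio, ratio, den'_cons, den'_cons]
    push_cast
    field_simp
  have e4 : (den (b :: u) : ℂ) ^ (-k) = (den (a :: u) : ℂ) ^ (-k) *
      (((den (a :: u) : ℝ) / den (b :: u) : ℝ) : ℂ) ^ k := by
    have h1 := Complex.mul_cpow_ofReal_nonneg (a := (den (a :: u) : ℝ) / den (b :: u))
      (b := (den (b :: u) : ℝ)) (by positivity) hdb.le k
    rw [← Complex.ofReal_mul, div_mul_cancel₀ _ hdb.ne'] at h1
    have hda' : (den (a :: u) : ℂ) ≠ 0 := by exact_mod_cast hda.ne'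
    have hdb' : (den (b :: u) : ℂ) ≠ 0 := by exact_mod_cast hdb.ne'
    have n1 : (den (a :: u) : ℂ) ^ k ≠ 0 := fun h => hda' ((Complex.cpow_eq_zero_iff _ _).1 h).1
    have n2 : (den (b :: u) : ℂ) ^ k ≠ 0 := fun h => hdb' ((Complex.cpow_eq_zero_iff _ _).1 h).1
    rw [Complex.ofReal_natCast, Complex.ofReal_natCast] at h1
    rw [Complex.cpow_neg, Complex.cpow_neg]
    field_simp
    rw [h1, mul_comm]
  rw [e1, e2, e3, e4]
  ring

lemma exists_ge_neg_one_pow {σ : ℝ} (hσ : σ = 1 ∨ σ = -1) (m n₀ : ℕ) :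
    ∃ n ≥ n₀, (-1 : ℝ) ^ (m + n) = σ := by
  rcases hσ with rfl | rfl
  · rcases Nat.even_or_odd (m + n₀) with he | ho
    · exact ⟨n₀, le_rfl, he.neg_one_pow⟩
    · exact ⟨n₀ + 1, by omega, by rw [← add_assoc]; exact ho.add_one.neg_one_pow⟩
  · rcases Nat.even_or_odd (m + n₀) with he | ho
    · exact ⟨n₀ + 1, by omega, by rw [← add_assoc]; exact he.add_one.neg_one_pow⟩
    · exact ⟨n₀, le_rfl, ho.neg_one_pow⟩

/-- Two prolongations by one digit both stay within O(q^{-Re k}) of r, while their difference is at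
least κ|h| q^{-Re k}. The hypothesis `hchoice` abstracts how the phase is controlled, so real and
non-real k share the argument. -/
lemma NearLevel.false_of_unbounded {N : ℕ} (hN : ϑ ^ N = 1) (h0 : 0 < N) (hk : 0 < k.re)
    (hx : x ∈ unitIrr) (hnear : NearLevel k ϑ h c φ r K x) (hK : 0 ≤ K) {σ : ℝ}
    (hσ : σ = 1 ∨ σ = -1) (htend : Tendsto (fun y => ‖h (σ * y)‖) (𝓝[>] 0) atTop)
    {ε : ℝ} (hε : ε ∈ Set.Ioo (0 : ℝ) 1) {good : Set ℂ} {κ : ℝ} (hκ : 0 < κ)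
    (hlow : ∀ᶠ y in 𝓝[>] (0 : ℝ), ∀ U ∈ logShell ε, ∀ ζ ∈ good,
      κ ≤ |φ (ζ * relDiff k h U (σ * y))|)
    {η : ℝ} (hη : 0 < η)
    (hchoice : ∀ L₀ : ℝ, ∃ L₁ : ℝ, ∀ u, PosWord u → ∃ L ∈ Set.Icc L₀ L₁, ∃ a : ℤ, ∀ b : ℕ,
      0 < b → (b : ℤ) ≡ a [ZMOD N] → |Real.log (b + ratio u) - L| < η →
        phase k ϑ (b :: u) ∈ good) : False := by
  have hεlt : ε < ε ^ (2 / 3 : ℝ) := by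
    nth_rewrite 1 [← Real.rpow_one ε]
    exact Real.rpow_lt_rpow_of_exponent_gt hε.1 hε.2 (by norm_num)
  have hε1 : ε ^ (2 / 3 : ℝ) ≤ 1 := Real.rpow_le_one hε.1.le hε.2.le (by norm_num)
  set ε' := ε ^ (2 / 3 : ℝ) with hε'
  -- The midpoint of the shell; the two errors in the logarithms add up to at most a quarter of its
  -- width, so log U stays inside.
  set θ := (ε + ε') / 2 with hθ
  have hθpos : 0 < θ := by have := hε.1; positivity
  set η' := min η ((ε' - ε) / 8) with hη'
  have hη'0 : 0 < η' := lt_min hη (by linarith)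
  have hη'1 : η' ≤ η := min_le_left _ _
  have hη'2 : η' ≤ (ε' - ε) / 8 := min_le_right _ _
  obtain ⟨L₀, hL₀⟩ := exists_digit_log h0 hη'0
  obtain ⟨y₀, hy₀, hy⟩ := mem_nhdsGT_iff_exists_Ioo_subset.1
    (hlow.and (htend.eventually_gt_atTop (K * (1 + Real.exp k.re) / κ)))
  have hy₀' : (0 : ℝ) < y₀ := hy₀
  obtain ⟨L₁, hL₁⟩ := hchoice (max L₀ (Real.log (1 / y₀) + η'))
  -- `NearLevel` is not uniform in w, so the candidate digits must lie in a finite set fixed before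
  -- n; this is why `L₁` may not depend on u.
  set B := ⌊Real.exp (L₁ + θ)⌋₊ with hB
  have hall : ∀ᶠ n in atTop, ∀ b ∈ Finset.Icc 1 B,
      |φ (psum k ϑ h c ([b] ++ word x n)) - r| ≤ K * (den ([b] ++ word x n) : ℝ) ^ (-k.re) := by
    rw [Finset.eventually_all]
    intro b hb
    exact hnear [b] (by simpa [Nat.pos_iff_ne_zero, Nat.one_le_iff_ne_zero] using (Finset.mem_Icc.1 hb).1)
  obtain ⟨n₀, hn₀⟩ := eventually_atTop.1 hall
  -- The parity of n decides on which side of 0 the argument of h lies.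
  obtain ⟨n, hn, hside⟩ := exists_ge_neg_one_pow hσ 2 n₀
  have hn' := hn₀ n hn
  set u := word x n with hu
  have hup : PosWord u := posWord_word hx n
  have hr0 : (0 : ℝ) ≤ ratio u := by exact_mod_cast ratio_nonneg u
  have hr1 : (ratio u : ℝ) ≤ 1 := by exact_mod_cast ratio_le_one hup
  obtain ⟨L, hL, q, hq⟩ := hL₁ u hup
  have hLL₀ : L₀ ≤ L := (le_max_left _ _).trans hL.1
  have hLy : Real.log (1 / y₀) + η' ≤ L := (le_max_right _ _).trans hL.1
  obtain ⟨a, ha0, haB, haq, haL⟩ := hL₀ L hLL₀ (ratio u) ⟨hr0, hr1⟩ q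
  obtain ⟨b, hb0, hbB, hbq, hbL⟩ := hL₀ (L + θ) (by linarith) (ratio u) ⟨hr0, hr1⟩ q
  have haB' : a ≤ B := Nat.le_floor (haB.trans (Real.exp_le_exp.2 (by linarith [hL.2])))
  have hbB' : b ≤ B := Nat.le_floor (hbB.trans (Real.exp_le_exp.2 (by linarith [hL.2])))
  have hna := hn' a (Finset.mem_Icc.2 ⟨ha0, haB'⟩)
  have hnb := hn' b (Finset.mem_Icc.2 ⟨hb0, hbB'⟩)
  have hpa : PosWord (a :: u) := posWord_cons.2 ⟨ha0, hup⟩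
  have hpb : PosWord (b :: u) := posWord_cons.2 ⟨hb0, hup⟩
  have hda : (0 : ℝ) < den (a :: u) := by exact_mod_cast den_pos hpa
  have hdb : (0 : ℝ) < den (b :: u) := by exact_mod_cast den_pos hpb
  have hdiff := term_sub_term (k := k) (h := h) (φ := φ) hN h0 ha0 hb0 hup (haq.trans hbq.symm)
  have hside' : side (a :: u) = σ := by
    rw [side, List.length_cons, hu, length_word, ← hside]; ring
  rw [hside'] at hdiff
  set U : ℝ := (den (a :: u) : ℝ) / den (b :: u) with hU
  have hUpos : 0 < U := div_pos hda hdb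
  have hlogU : Real.log U = Real.log (a + ratio u) - Real.log (b + ratio u) := by
    rw [hU, Real.log_div hda.ne' hdb.ne', log_den_cons ha0 hup, log_den_cons hb0 hup]; ring
  rw [abs_lt] at haL hbL
  have hlogU1 : ε < -Real.log U := by rw [hlogU]; linarith
  have hlogU2 : -Real.log U < ε' := by rw [hlogU]; linarith
  have hUshell : U ∈ logShell ε := by
    refine ⟨hUpos, ?_⟩
    rw [abs_of_neg (by linarith [hε.1])]
    exact ⟨hlogU1, hlogU2⟩
  have hU1 : U ≤ 1 := by
    rw [← Real.log_nonpos_iff hUpos.le]; linarith [hε.1]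
  set X : ℝ := (ratio (a :: u) : ℝ) with hX
  have hXpos : 0 < X := by rw [hX]; exact_mod_cast ratio_pos hpa (by simp)
  have hXlt : X < y₀ := by
    have hXe : X = 1 / (a + ratio u) := by rw [hX, ratio_cons hup]; push_cast; rfl
    have hpos : (0 : ℝ) < a + ratio u := by
      have : (0 : ℝ) < a := by exact_mod_cast ha0
      positivity
    have : Real.log (1 / y₀) < Real.log (a + ratio u) := by linarith
    have := (Real.log_lt_log_iff (by positivity) hpos).1 this
    rw [hXe]
    exact (one_div_lt hy₀' hpos).1 this
  obtain ⟨hlowX, hbig⟩ := hy ⟨hXpos, hXlt⟩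
  have hgood : phase k ϑ (a :: u) ∈ good :=
    hq a ha0 haq (lt_of_lt_of_le (abs_lt.2 haL) hη'1)
  have hfinal := hlowX U hUshell _ hgood
  have hhpos : 0 < ‖h (σ * X)‖ := lt_of_le_of_lt (by positivity) hbig
  have hrel : φ (phase k ϑ (a :: u) * relDiff k h U (σ * X)) = ‖h (σ * X)‖⁻¹ *
      φ (phase k ϑ (a :: u) * (h (σ * X) - (U : ℂ) ^ k * h (U * (σ * X)))) := by
    rw [← smul_eq_mul (‖h (σ * X)‖⁻¹), ← map_smul]
    congr 1
    rw [relDiff, Complex.real_smul]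
    push_cast
    ring
  have hbound : |φ (phase k ϑ (a :: u) * (h (σ * X) - (U : ℂ) ^ k * h (U * (σ * X))))| ≤
      K * (1 + Real.exp k.re) := by
    set W := φ (phase k ϑ (a :: u) * (h (σ * X) - (U : ℂ) ^ k * h (U * (σ * X)))) with hW
    have h1 : |φ (term k ϑ h (a :: u)) - φ (term k ϑ h (b :: u))| ≤
        K * (den (a :: u) : ℝ) ^ (-k.re) + K * (den (b :: u) : ℝ) ^ (-k.re) := by
      simp only [List.singleton_append, psum, map_add] at hna hnb
      rw [abs_le] at hna hnb ⊢
      constructor <;> linarith [hna.1, hna.2, hnb.1, hnb.2]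
    rw [hdiff, abs_mul, abs_of_pos (by positivity)] at h1
    have h2 : (den (b :: u) : ℝ) ^ (-k.re) = U ^ k.re * (den (a :: u) : ℝ) ^ (-k.re) := by
      rw [hU, Real.div_rpow hda.le hdb.le, Real.rpow_neg hda.le, Real.rpow_neg hdb.le]
      have := (Real.rpow_pos_of_pos hda k.re).ne'
      field_simp
    rw [h2] at h1
    have hp : 0 < (den (a :: u) : ℝ) ^ (-k.re) := by positivity
    have h3 : |W| ≤ K * (1 + U ^ k.re) := by
      refine le_of_mul_le_mul_left ?_ hp
      linarith
    refine h3.trans ?_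
    gcongr
    exact (Real.rpow_le_one hUpos.le hU1 hk.le).trans (Real.one_le_exp hk.le)
  rw [hrel, abs_mul, abs_of_pos (by positivity)] at hfinal
  rw [div_lt_iff₀ hκ] at hbig
  have : κ ≤ ‖h (σ * X)‖⁻¹ * (K * (1 + Real.exp k.re)) :=
    hfinal.trans (by gcongr)
  rw [inv_mul_eq_div, le_div_iff₀ hhpos] at this
  linarith

lemma NearLevel.false_of_unboundedCondition {N : ℕ} (hN : ϑ ^ N = 1) (h0 : 0 < N)
    (hk : 0 < k.re) (hx : x ∈ unitIrr) (hnear : NearLevel k ϑ h c φ r K x) (hK : 0 ≤ K) {σ : ℝ}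
    (hσ : σ = 1 ∨ σ = -1) {l : Filter ℝ} (hl : Tendsto (fun y => σ * y) (𝓝[>] 0) l)
    (hh : UnboundedCondition k ϑ φ h l) : False := by
  obtain ⟨htend, -, hcase⟩ := hh
  have hε01 : ∀ᶠ ε in 𝓝[>] (0 : ℝ), ε ∈ Set.Ioo (0 : ℝ) 1 := Ioo_mem_nhdsGT one_pos
  rcases hcase with ⟨him, p, hp⟩ | ⟨him, β, hβ⟩
  · obtain ⟨ε, hε, hε1⟩ := (hp.and hε01).exists
    obtain ⟨κ, hκ0, hκ⟩ := ENNReal.lt_iff_exists_nnreal_btwn.1 hε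
    have hκ0' : (0 : ℝ) < κ := by exact_mod_cast hκ0
    refine hnear.false_of_unbounded hN h0 hk hx hK hσ (htend.comp hl) hε1 (good := {ϑ ^ p}) hκ0'
      ?_ one_pos fun L₀ => ⟨L₀, fun u _ => ⟨L₀, ⟨le_rfl, le_rfl⟩, ?_⟩⟩
    · filter_upwards [hl.eventually (eventually_lt_of_lt_liminf hκ)] with y hy U hU ζ hζ
      rw [Set.mem_singleton_iff.1 hζ]
      have h1 := hy.le.trans (iInf₂_le U hU)
      rw [← ENNReal.ofReal_coe_nnreal] at h1
      exact (ENNReal.ofReal_le_ofReal_iff (abs_nonneg _)).1 h1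
    · obtain ⟨a, ha⟩ := exists_digit_phase_real (k := k) hN h0 him p u
      exact ⟨a, fun b _ hb _ => ha b hb⟩
  · obtain ⟨ε, hε, hε1⟩ := (hβ.and hε01).exists
    obtain ⟨κ, hκ0, hκ⟩ := ENNReal.lt_iff_exists_nnreal_btwn.1 hε
    have hκ0' : (0 : ℝ) < κ := by exact_mod_cast hκ0
    have hε' : 0 < ε ^ (2 / 3 : ℝ) := Real.rpow_pos_of_pos hε1.1 _
    have hτ : 0 < |k.im| := abs_pos.2 him
    have hpi := Real.pi_pos
    refine hnear.false_of_unbounded hN h0 hk hx hK hσ (htend.comp hl) hε1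
      (good := {ζ | ∃ α : ℝ, |α - β| < ε ^ (2 / 3 : ℝ) ∧
        ζ = Complex.exp (2 * Real.pi * Complex.I * α)}) hκ0' ?_
      -- A deviation below η in the logarithm moves α by less than |Im k| η/(2π) = ε^{2/3}.
      (η := 2 * Real.pi * ε ^ (2 / 3 : ℝ) / |k.im|) (by positivity)
      fun L₀ => ⟨L₀ + 2 * Real.pi / |k.im|, fun u hu => ?_⟩
    · filter_upwards [hl.eventually (eventually_lt_of_lt_liminf hκ)] with y hy U hU ζ hζ
      obtain ⟨α, hα, rfl⟩ := hζ
      have h1 := hy.le.trans ((iInf₂_le U hU).trans (iInf₂_le α hα))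
      rw [← ENNReal.ofReal_coe_nnreal] at h1
      exact (ENNReal.ofReal_le_ofReal_iff (abs_nonneg _)).1 h1
    · obtain ⟨L, hL, hb⟩ := exists_log_phase hN h0 him β L₀ hu
      refine ⟨L, hL, 0, fun b hb0 hbN hbL => ⟨_, ?_, hb b hb0 hbN⟩⟩
      rw [sub_sub_cancel_left, abs_neg, abs_div, abs_mul, abs_of_pos (show 0 < 2 * Real.pi by
        positivity), div_lt_iff₀ (by positivity)]
      rw [lt_div_iff₀ hτ] at hbL
      linarith

end Unbounded

/-! ### Contradiction in the bounded case -/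

section Bounded

variable {k ϑ c : ℂ} {h : ℝ → ℂ} {φ : ℂ →ₗ[ℝ] ℝ} {r K x : ℝ}

lemma exists_abs_map_le (φ : ℂ →ₗ[ℝ] ℝ) : ∃ M : ℝ, 0 < M ∧ ∀ z, |φ z| ≤ M * ‖z‖ := by
  refine ⟨‖φ.toContinuousLinearMap‖ + 1, by positivity, fun z => ?_⟩
  refine (φ.toContinuousLinearMap.le_opNorm z).trans ?_
  gcongr
  linarith

/-- For a bounded period function the constant in `NearLevel` may be taken arbitrarily small. -/
lemma NearLevel.mono_of_bounded (hϑ : ‖ϑ‖ = 1) (hk : 0 < k.re) (hx : x ∈ unitIrr)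
    (hnear : NearLevel k ϑ h c φ r K x) (hK : 0 ≤ K) {C : ℝ}
    (hC : ∀ y : ℝ, y ≠ 0 → |y| ≤ 1 → ‖h y‖ ≤ C) {η : ℝ} (hη : 0 < η) :
    NearLevel k ϑ h c φ r η x := by
  intro w hw
  obtain ⟨M, hM, hφ⟩ := exists_abs_map_le φ
  have hC0 : 0 ≤ C := (norm_nonneg _).trans (hC 1 one_ne_zero (by simp))
  have ht : Tendsto (fun B : ℕ => (K + M * C) * (B : ℝ) ^ (-k.re)) atTop (𝓝 0) := by
    have := ((tendsto_rpow_neg_atTop hk).comp tendsto_natCast_atTop_atTop).const_mul (K + M * C)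
    rwa [mul_zero] at this
  obtain ⟨B, hB, hB0⟩ := ((ht.eventually (gt_mem_nhds hη)).and (eventually_gt_atTop 0)).exists
  -- A further digit B costs one term of size O(q^{-Re k}) at the new denominator, which exceeds the
  -- old one by a factor of at least B; for large B the constant drops below η.
  filter_upwards [hnear (B :: w) (posWord_cons.2 ⟨hB0, hw⟩)] with n hn
  set v := w ++ word x n
  have hv : PosWord v := posWord_append.2 ⟨hw, posWord_word hx n⟩
  have hBv : PosWord (B :: v) := posWord_cons.2 ⟨hB0, hv⟩
  have hB0' : (0 : ℝ) < B := by exact_mod_cast hB0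
  have hd : (0 : ℝ) < den v := by exact_mod_cast den_pos hv
  have hr0 : (0 : ℝ) < ratio (B :: v) := by exact_mod_cast ratio_pos hBv (by simp)
  have habs := abs_side_mul_ratio (B :: v)
  have hterm : |φ (term k ϑ h (B :: v))| ≤ M * C * (den (B :: v) : ℝ) ^ (-k.re) := by
    refine (hφ _).trans ?_
    rw [norm_term_le hϑ hBv, mul_assoc, mul_comm C]
    gcongr
    refine hC _ (fun h0 => ?_) ?_
    · rw [h0, abs_zero] at habs; exact hr0.ne habs
    · rw [habs]; exact_mod_cast ratio_le_one hBv
  have hden : (den (B :: v) : ℝ) ^ (-k.re) ≤ (B : ℝ) ^ (-k.re) * (den v : ℝ) ^ (-k.re) := by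
    rw [← Real.mul_rpow hB0'.le hd.le]
    exact Real.rpow_le_rpow_of_nonpos (by positivity)
      (by exact_mod_cast mul_den_le_den_cons B v) (by linarith)
  have h1 : |φ (psum k ϑ h c v) - r| ≤ (K + M * C) * (den (B :: v) : ℝ) ^ (-k.re) := by
    rw [List.cons_append, psum, map_add] at hn
    rw [abs_le] at hn hterm ⊢
    constructor <;> linarith [hn.1, hn.2, hterm.1, hterm.2]
  calc _ ≤ (K + M * C) * (den (B :: v) : ℝ) ^ (-k.re) := h1
    _ ≤ (K + M * C) * ((B : ℝ) ^ (-k.re) * (den v : ℝ) ^ (-k.re)) := by gcongr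
    _ = (K + M * C) * (B : ℝ) ^ (-k.re) * (den v : ℝ) ^ (-k.re) := by ring
    _ ≤ η * (den v : ℝ) ^ (-k.re) := by gcongr

/-- The newest term is the difference of two partial sums close to r. Removing the newest digit b
costs at most (b+1)^{Re k} in q^{-Re k}, which `D` absorbs. -/
lemma eventually_abs_map_phase_le (hk : 0 < k.re) (hx : x ∈ unitIrr)
    (hnear : ∀ η : ℝ, 0 < η → NearLevel k ϑ h c φ r η x) {w : List ℕ} (hw : PosWord w)
    (hne : w ≠ []) {η : ℝ} (hη : 0 < η) :
    ∀ᶠ n in atTop, |φ (phase k ϑ (w ++ word x n) *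
      h (side (w ++ word x n) * ratio (w ++ word x n)))| ≤ η := by
  obtain ⟨b, w, rfl⟩ := List.exists_cons_of_ne_nil hne
  have hw' := posWord_cons.1 hw
  set D : ℝ := 1 + ((b : ℝ) + 1) ^ k.re with hD
  have hD0 : 0 < D := by positivity
  have hη' : 0 < η / D := by positivity
  filter_upwards [hnear _ hη' (b :: w) hw, hnear _ hη' w hw'.2] with n h1 h2
  rw [List.cons_append] at h1 ⊢
  set v := w ++ word x n
  have hv : PosWord v := posWord_append.2 ⟨hw'.2, posWord_word hx n⟩
  have hbv : PosWord (b :: v) := posWord_cons.2 ⟨hw'.1, hv⟩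
  have hd : (0 : ℝ) < den v := by exact_mod_cast den_pos hv
  have hdb : (0 : ℝ) < den (b :: v) := by exact_mod_cast den_pos hbv
  have hle : (den (b :: v) : ℝ) ≤ (b + 1) * den v := by exact_mod_cast den_cons_le hv
  have hden : (den v : ℝ) ^ (-k.re) ≤ ((b : ℝ) + 1) ^ k.re * (den (b :: v) : ℝ) ^ (-k.re) := by
    rw [Real.rpow_neg hd.le, Real.rpow_neg hdb.le, ← div_eq_mul_inv, le_div_iff₀ (by positivity),
      inv_mul_le_iff₀ (by positivity), mul_comm, ← Real.mul_rpow (by positivity) hd.le]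
    exact Real.rpow_le_rpow hdb.le hle hk.le
  have h3 : |φ (term k ϑ h (b :: v))| ≤ η / D * (D * (den (b :: v) : ℝ) ^ (-k.re)) := by
    rw [psum, map_add] at h1
    have h4 : η / D * (den v : ℝ) ^ (-k.re) ≤
        η / D * (((b : ℝ) + 1) ^ k.re * (den (b :: v) : ℝ) ^ (-k.re)) := by gcongr
    have h5 : η / D * (D * (den (b :: v) : ℝ) ^ (-k.re)) =
        η / D * (den (b :: v) : ℝ) ^ (-k.re) +
          η / D * (((b : ℝ) + 1) ^ k.re * (den (b :: v) : ℝ) ^ (-k.re)) := by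
      rw [hD]; ring
    rw [h5]
    rw [abs_le] at h1 h2 ⊢
    constructor <;> linarith [h1.1, h1.2, h2.1, h2.2]
  rw [map_term φ hbv, abs_mul, abs_of_pos (by positivity), ← mul_assoc,
    div_mul_cancel₀ _ hD0.ne', mul_comm η] at h3
  exact le_of_mul_le_mul_left h3 (by positivity)

/-- Take l to be enough leading digits of |β|, with β irrational just to the right of α. By
contraction of the branch, the ratio of l ++ u is close to |β| whatever u is. Passing to β also
covers α = 0 and rational α. -/
lemma exists_word_near {H : ℝ → ℂ} (hcont : ContinuousOn H (Set.Icc (-1) 1))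
    (hH : ∀ y ∈ Set.Icc (-1 : ℝ) 1, y ≠ 0 → H y = h y) {α : ℝ} (hα : α ∈ Set.Ioo (-1 : ℝ) 1)
    {η : ℝ} (hη : 0 < η) :
    ∃ σ : ℝ, (σ = 1 ∨ σ = -1) ∧ ∃ l : List ℕ, PosWord l ∧
      ∀ u, PosWord u → u ≠ [] → ‖h (σ * ratio (l ++ u)) - H α‖ ≤ η := by
  obtain ⟨ε, hε, hball⟩ := Metric.continuousOn_iff.1 hcont α ⟨hα.1.le, hα.2.le⟩ η hη
  obtain ⟨β, hβirr, hβ1, hβ2⟩ := exists_irrational_btwn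
    (show α < min 1 (α + ε / 2) from lt_min hα.2 (by linarith))
  have hβ3 : β < 1 := hβ2.trans_le (min_le_left _ _)
  have hβ4 : β < α + ε / 2 := hβ2.trans_le (min_le_right _ _)
  have hβ0 : β ≠ 0 := hβirr.ne_zero
  obtain ⟨σ, hσ, hσβ⟩ : ∃ σ : ℝ, (σ = 1 ∨ σ = -1) ∧ β = σ * |β| := by
    rcases lt_or_gt_of_ne hβ0 with hneg | hpos
    · exact ⟨-1, Or.inr rfl, by rw [abs_of_neg hneg]; ring⟩
    · exact ⟨1, Or.inl rfl, by rw [abs_of_pos hpos]; ring⟩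
  have habsσ : |σ| = 1 := by rcases hσ with rfl | rfl <;> simp
  have hI : |β| ∈ unitIrr := by
    refine ⟨⟨abs_pos.2 hβ0, abs_lt.2 ⟨by linarith [hα.1], hβ3⟩⟩, ?_⟩
    rcases abs_choice β with e | e <;> rw [e]
    · exact hβirr
    · exact hβirr.neg
  have ht : Tendsto (fun m => ((den (word |β| m) : ℝ) ^ 2)⁻¹) atTop (𝓝 0) :=
    tendsto_inv_atTop_zero.comp
      ((tendsto_pow_atTop (α := ℝ) two_ne_zero).comp (tendsto_den_word hI))
  obtain ⟨m, hm⟩ := (ht.eventually (gt_mem_nhds (half_pos hε))).exists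
  have hp := posWord_word hI m
  refine ⟨σ, hσ, (word |β| m).reverse, posWord_reverse.2 hp, fun u hu hune => ?_⟩
  set l := (word |β| m).reverse with hl
  have hlu : PosWord (l ++ u) := posWord_append.2 ⟨posWord_reverse.2 hp, hu⟩
  have hy0 : (0 : ℝ) < ratio (l ++ u) := by
    exact_mod_cast ratio_pos hlu (by simp [hune])
  have hy1 : (ratio (l ++ u) : ℝ) ≤ 1 := by exact_mod_cast ratio_le_one hlu
  have hu0 : (0 : ℝ) ≤ ratio u := by exact_mod_cast ratio_nonneg u
  have hu1 : (ratio u : ℝ) ≤ 1 := by exact_mod_cast ratio_le_one hu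
  have hclose : |(ratio (l ++ u) : ℝ) - abs β| < ε / 2 := by
    have hT := iterate_gaussMap_mem hI m
    rw [hl, ratio_reverse_append hp hu]
    nth_rewrite 2 [← mobius_word hI m]
    refine (mobius_sub_le hp hu0 hT.1.1.le).trans_lt (lt_of_le_of_lt ?_ hm)
    refine mul_le_of_le_one_right (by positivity) ?_
    rw [abs_le]
    constructor <;> linarith [hT.1.1, hT.1.2]
  have hmem : σ * (ratio (l ++ u) : ℝ) ∈ Set.Icc (-1 : ℝ) 1 := by
    rw [Set.mem_Icc, ← abs_le, abs_mul, habsσ, one_mul, abs_of_pos hy0]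
    exact hy1
  have hne : σ * (ratio (l ++ u) : ℝ) ≠ 0 := by
    rcases hσ with rfl | rfl <;> simpa using hy0.ne'
  rw [← hH _ hmem hne, ← dist_eq_norm]
  refine (hball _ hmem ?_).le
  have h1 : |σ * (ratio (l ++ u) : ℝ) - β| < ε / 2 := by
    nth_rewrite 1 [hσβ]
    rw [← mul_sub, abs_mul, habsσ, one_mul]
    exact hclose
  rw [Real.dist_eq]
  rw [abs_lt] at h1 ⊢
  constructor <;> linarith [h1.1, h1.2]

/-- With A = φ(z) and B = φ(iz), the rotated value is A cos θ + B sin θ, and A² + B² is (φ(1)² +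
φ(i)²)|z|². Smallness in two directions gives |A| ≤ η and |B sin θ| ≤ 2η, whence 5 = 1 + 2². -/
lemma sin_sq_mul_normSq_le (φ : ℂ →ₗ[ℝ] ℝ) (z : ℂ) (θ η : ℝ) (h1 : |φ z| ≤ η)
    (h2 : |φ (Complex.exp (θ * Complex.I) * z)| ≤ η) :
    Real.sin θ ^ 2 * (φ 1 ^ 2 + φ Complex.I ^ 2) * ‖z‖ ^ 2 ≤ 5 * η ^ 2 := by
  have hφ : ∀ a b : ℝ, φ (a + b * Complex.I) = a * φ 1 + b * φ Complex.I := fun a b => by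
    have : (a : ℂ) + b * Complex.I = a • (1 : ℂ) + b • Complex.I := by simp
    rw [this, map_add, map_smul, map_smul, smul_eq_mul, smul_eq_mul]
  have e1 : φ z = z.re * φ 1 + z.im * φ Complex.I := by
    rw [← hφ, Complex.re_add_im]
  have e2 : φ (Complex.exp (θ * Complex.I) * z) = Real.cos θ * φ z +
      Real.sin θ * (-z.im * φ 1 + z.re * φ Complex.I) := by
    have : Complex.exp (θ * Complex.I) * z =
        ((Real.cos θ * z.re - Real.sin θ * z.im : ℝ) : ℂ) +
          ((Real.cos θ * z.im + Real.sin θ * z.re : ℝ) : ℂ) * Complex.I := by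
      rw [Complex.exp_mul_I, ← Complex.ofReal_cos, ← Complex.ofReal_sin]
      apply Complex.ext <;> simp
    rw [this, hφ, e1]; ring
  set A := φ z
  set B := -z.im * φ 1 + z.re * φ Complex.I
  have e3 : (φ 1 ^ 2 + φ Complex.I ^ 2) * ‖z‖ ^ 2 = A ^ 2 + B ^ 2 := by
    rw [← Complex.normSq_eq_norm_sq, Complex.normSq_apply, e1]; ring
  have hη : 0 ≤ η := (abs_nonneg _).trans h1
  have hA : A ^ 2 ≤ η ^ 2 := sq_le_sq' (abs_le.1 h1).1 (abs_le.1 h1).2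
  have hcos := Real.abs_cos_le_one θ
  have hcA : |Real.cos θ * A| ≤ η := by
    rw [abs_mul]
    calc _ ≤ 1 * η := by gcongr
      _ = η := one_mul _
  have hsB : |Real.sin θ * B| ≤ 2 * η := by
    rw [e2] at h2
    rw [abs_le] at h2 hcA ⊢
    constructor <;> linarith [h2.1, h2.2, hcA.1, hcA.2]
  have hsB2 : (Real.sin θ * B) ^ 2 ≤ (2 * η) ^ 2 :=
    sq_le_sq' (abs_le.1 hsB).1 (abs_le.1 hsB).2
  have hs1 : Real.sin θ ^ 2 ≤ 1 := Real.sin_sq_le_one θ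
  have : Real.sin θ ^ 2 * A ^ 2 ≤ 1 * η ^ 2 := by gcongr
  rw [mul_assoc, e3]
  linarith

lemma sq_add_sq_pos_of_ne_zero {φ : ℂ →ₗ[ℝ] ℝ} (hφ : φ ≠ 0) :
    0 < φ 1 ^ 2 + φ Complex.I ^ 2 := by
  by_contra! hle
  have h1 : φ 1 = 0 := by nlinarith [sq_nonneg (φ 1), sq_nonneg (φ Complex.I)]
  have h2 : φ Complex.I = 0 := by nlinarith [sq_nonneg (φ 1), sq_nonneg (φ Complex.I)]
  refine hφ (Complex.basisOneI.ext fun i => ?_)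
  fin_cases i <;> simp [h1, h2]

lemma side_append_cons_word (l : List ℕ) (a : ℕ) (x : ℝ) (n : ℕ) :
    side (l ++ a :: word x n) = (-1) ^ (l.length + 2 + n) := by
  rw [side, List.length_append, List.length_cons, length_word]
  congr 1; ring

/-- A digit a is inserted between the initial word of x and l: its residue makes the phase ϑ^p,
while l keeps the argument near α. The residue depends on n, so all a ≤ N are prepared beforehand.
-/
lemma false_of_bounded_real {N : ℕ} (hN : ϑ ^ N = 1) (h0 : 0 < N) (hk : 0 < k.re)
    (hx : x ∈ unitIrr) (hnear : ∀ η : ℝ, 0 < η → NearLevel k ϑ h c φ r η x)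
    {H : ℝ → ℂ} (hcont : ContinuousOn H (Set.Icc (-1) 1))
    (hH : ∀ y ∈ Set.Icc (-1 : ℝ) 1, y ≠ 0 → H y = h y) {α : ℝ} (hα : α ∈ Set.Ioo (-1 : ℝ) 1)
    (him : k.im = 0) (p : ℤ) (hne : φ (ϑ ^ p * H α) ≠ 0) : False := by
  obtain ⟨M, hM, hφ⟩ := exists_abs_map_le φ
  have hϑ := norm_eq_one_of_pow hN h0
  set e := |φ (ϑ ^ p * H α)| with he
  have hepos : 0 < e := abs_pos.2 hne
  obtain ⟨σ, hσ, l, hl, hnear'⟩ := exists_word_near hcont hH hα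
    (show 0 < e / (4 * M) by positivity)
  have hall : ∀ᶠ n in atTop, ∀ a ∈ Finset.Icc 1 N, |φ (phase k ϑ ((l ++ [a]) ++ word x n) *
      h (side ((l ++ [a]) ++ word x n) * ratio ((l ++ [a]) ++ word x n)))| ≤ e / 4 := by
    rw [Finset.eventually_all]
    intro a ha
    have ha' : 0 < a := (Finset.mem_Icc.1 ha).1
    exact eventually_abs_map_phase_le hk hx hnear (by simp [hl, ha']) (by simp) (by positivity)
  obtain ⟨n₀, hn₀⟩ := eventually_atTop.1 hall
  obtain ⟨n, hn, hside⟩ := exists_ge_neg_one_pow hσ (l.length + 2) n₀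
  obtain ⟨q, hq⟩ := exists_forall_twist_modEq l (word x n) N p
  obtain ⟨a, ha0, haN, haq⟩ := exists_digit_modEq h0 q
  have h1 := hn₀ n hn a (Finset.mem_Icc.2 ⟨ha0, haN⟩)
  rw [List.append_assoc, List.singleton_append, side_append_cons_word, hside, phase,
    zpow_eq_of_modEq hN h0 (hq a haq), him] at h1
  simp only [zero_mul, neg_zero, Complex.ofReal_zero, Complex.exp_zero, mul_one] at h1
  have h2 := hnear' (a :: word x n) (posWord_cons.2 ⟨ha0, posWord_word hx n⟩) (by simp)
  set y : ℂ := h (σ * ratio (l ++ a :: word x n))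
  have h3 : |φ (ϑ ^ p * (y - H α))| ≤ e / 4 := by
    refine (hφ _).trans ?_
    rw [norm_mul, norm_zpow, hϑ, one_zpow, one_mul]
    calc M * ‖y - H α‖ ≤ M * (e / (4 * M)) := by gcongr
      _ = e / 4 := by field_simp
  rw [mul_sub, map_sub] at h3
  have h4 : e ≤ e / 2 := by
    rw [abs_le] at h1 h3
    refine abs_le.2 ⟨?_, ?_⟩ <;> linarith [h1.1, h1.2, h3.1, h3.2]
  linarith

/-- Replacing a by a + N increases the denominator by a relative amount between N/(a+2) and N/a,
uniformly in l and u; a > |τ|N keeps the angle at most 1. -/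
lemma exists_log_den_ratio {N : ℕ} (h0 : 0 < N) {τ : ℝ} (hτ : τ ≠ 0) :
    ∃ a : ℕ, 0 < a ∧ ∃ θ₀ : ℝ, 0 < θ₀ ∧ ∀ l u, PosWord l → PosWord u →
      |τ * (Real.log (den (l ++ (a + N) :: u)) - Real.log (den (l ++ a :: u)))| ∈
        Set.Icc θ₀ 1 := by
  have hτ' : 0 < |τ| := abs_pos.2 hτ
  have hN' : (0 : ℝ) < N := by exact_mod_cast h0
  obtain ⟨a, ha⟩ := exists_nat_gt (|τ| * N)
  have ha0 : (0 : ℝ) < a := lt_trans (by positivity) ha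
  have hone : 0 < Real.log (1 + N / (a + 2)) :=
    Real.log_pos (by have : (0 : ℝ) < N / (a + 2) := by positivity
                     linarith)
  refine ⟨a, by exact_mod_cast ha0, |τ| * Real.log (1 + N / (a + 2)), by positivity,
    fun l u hl hu => ?_⟩
  obtain ⟨A, B, hA, hBA, hden⟩ := exists_den_append_eq l hl
  have hA' : (0 : ℝ) < A := by exact_mod_cast hA
  have hBA' : (B : ℝ) ≤ A := by exact_mod_cast hBA
  have hB' : (0 : ℝ) ≤ B := by positivity
  have hd : (0 : ℝ) < den u := by exact_mod_cast den_pos hu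
  have hd' : (0 : ℝ) ≤ den' u := by positivity
  have hdd : (den' u : ℝ) ≤ den u := by exact_mod_cast den'_le_den hu
  have e1 : (den (l ++ a :: u) : ℝ) = A * (a * den u + den' u) + B * den u := by
    rw [hden]; push_cast [den_cons, den'_cons]; rfl
  have e2 : (den (l ++ (a + N) :: u) : ℝ) = den (l ++ a :: u) + A * N * den u := by
    rw [e1, hden]; push_cast [den_cons, den'_cons]; ring
  set D : ℝ := (den (l ++ a :: u) : ℝ)
  have hDge : A * a * den u ≤ D := by
    rw [e1]
    have : 0 ≤ (A : ℝ) * den' u + B * den u := by positivity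
    linarith
  have hDpos : 0 < D := lt_of_lt_of_le (by positivity) hDge
  have hDle : D ≤ A * (a + 2) * den u := by
    rw [e1]
    have t1 : (A : ℝ) * den' u ≤ A * den u := by gcongr
    have t2 : (B : ℝ) * den u ≤ A * den u := by gcongr
    linarith
  have hlog : Real.log (den (l ++ (a + N) :: u)) - Real.log D =
      Real.log (1 + A * N * den u / D) := by
    rw [e2, ← Real.log_div (by positivity) hDpos.ne']
    congr 1
    field_simp
  have hs1 : N / ((a : ℝ) + 2) ≤ A * N * den u / D := by
    rw [div_le_div_iff₀ (by positivity) hDpos]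
    calc (N : ℝ) * D ≤ N * (A * (a + 2) * den u) := by gcongr
      _ = _ := by ring
  have hs2 : A * N * den u / D ≤ N / (a : ℝ) := by
    rw [div_le_div_iff₀ hDpos ha0]
    calc A * N * den u * (a : ℝ) = N * (A * a * den u) := by ring
      _ ≤ N * D := by gcongr
  have hge : Real.log (1 + N / (a + 2)) ≤ Real.log (1 + A * N * den u / D) :=
    Real.log_le_log (by positivity) (by linarith)
  rw [hlog, abs_mul, abs_of_pos (hone.trans_le hge)]
  refine ⟨by gcongr, ?_⟩
  have hle : Real.log (1 + A * N * den u / D) ≤ N / (a : ℝ) := by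
    have := Real.log_le_sub_one_of_pos (show 0 < 1 + A * N * den u / D by positivity)
    linarith
  calc |τ| * Real.log (1 + A * N * den u / D) ≤ |τ| * (N / a) := by gcongr
    _ = |τ| * N / a := by ring
    _ ≤ 1 := (div_le_one ha0).2 ha.le

/-- The digits a and a + N give the same power of ϑ, but phases rotated by an angle in [θ₀, 1]. Then
φ is small on two quantifiably independent multiples of H α, which forces H α to be small. -/
lemma false_of_bounded_complex {N : ℕ} (hN : ϑ ^ N = 1) (h0 : 0 < N) (hk : 0 < k.re)
    (hφ0 : φ ≠ 0) (hx : x ∈ unitIrr) (hnear : ∀ η : ℝ, 0 < η → NearLevel k ϑ h c φ r η x)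
    {H : ℝ → ℂ} (hcont : ContinuousOn H (Set.Icc (-1) 1))
    (hH : ∀ y ∈ Set.Icc (-1 : ℝ) 1, y ≠ 0 → H y = h y) {α : ℝ} (hα : α ∈ Set.Ioo (-1 : ℝ) 1)
    (him : k.im ≠ 0) (hne : H α ≠ 0) : False := by
  obtain ⟨M, hM, hφ⟩ := exists_abs_map_le φ
  have hϑ := norm_eq_one_of_pow hN h0
  obtain ⟨a, ha0, θ₀, hθ₀, hθ⟩ := exists_log_den_ratio h0 him
  have hpi := Real.pi_pos
  have hP := sq_add_sq_pos_of_ne_zero hφ0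
  have hHα : 0 < ‖H α‖ := norm_pos_iff.2 hne
  set P := φ 1 ^ 2 + φ Complex.I ^ 2
  set Q := (2 / Real.pi * θ₀) ^ 2 * P * ‖H α‖ ^ 2 with hQ
  have hQ0 : 0 < Q := by positivity
  -- Chosen so that 5η² = Q/2, half the lower bound `Q` for the left side of `sin_sq_mul_normSq_le`.
  set η := Real.sqrt (Q / 10) with hη
  have hη0 : 0 < η := Real.sqrt_pos.2 (by positivity)
  have hη2 : 5 * η ^ 2 < Q := by
    rw [hη, Real.sq_sqrt (by positivity)]; linarith
  obtain ⟨σ, hσ, l, hl, hnear'⟩ := exists_word_near hcont hH hα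
    (show 0 < η / (2 * M) by positivity)
  have hev : ∀ b : ℕ, 0 < b → ∀ᶠ n in atTop, |φ (phase k ϑ ((l ++ [b]) ++ word x n) *
      h (side ((l ++ [b]) ++ word x n) * ratio ((l ++ [b]) ++ word x n)))| ≤ η / 2 :=
    fun b hb => eventually_abs_map_phase_le hk hx hnear (by simp [hl, hb]) (by simp)
      (by positivity)
  obtain ⟨n₀, hn₀⟩ := eventually_atTop.1 ((hev a ha0).and (hev (a + N) (by omega)))
  obtain ⟨n, hn, hside⟩ := exists_ge_neg_one_pow hσ (l.length + 2) n₀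
  obtain ⟨h1, h2⟩ := hn₀ n hn
  have hu := posWord_word hx n
  set u := word x n with hu'
  have hmain : ∀ b : ℕ, 0 < b → |φ (phase k ϑ ((l ++ [b]) ++ u) *
      h (side ((l ++ [b]) ++ u) * ratio ((l ++ [b]) ++ u)))| ≤ η / 2 →
        |φ (phase k ϑ (l ++ b :: u) * H α)| ≤ η := by
    intro b hb h1
    rw [List.append_assoc, List.singleton_append, hu', side_append_cons_word, hside, ← hu'] at h1
    have h2 := hnear' (b :: u) (posWord_cons.2 ⟨hb, hu⟩) (by simp)
    set y : ℂ := h (σ * ratio (l ++ b :: u))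
    have h3 : |φ (phase k ϑ (l ++ b :: u) * (y - H α))| ≤ η / 2 := by
      refine (hφ _).trans ?_
      rw [norm_mul, norm_phase hϑ, one_mul]
      calc M * ‖y - H α‖ ≤ M * (η / (2 * M)) := by gcongr
        _ = η / 2 := by field_simp
    rw [mul_sub, map_sub] at h3
    rw [abs_le] at h1 h3 ⊢
    constructor <;> linarith [h1.1, h1.2, h3.1, h3.2]
  have g1 := hmain a ha0 h1
  have g2 := hmain (a + N) (by omega) h2
  set θ := k.im * (Real.log (den (l ++ (a + N) :: u)) - Real.log (den (l ++ a :: u))) with hθdef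
  have hθ' := hθ l u hl hu
  rw [← hθdef] at hθ'
  have hphase : phase k ϑ (l ++ (a + N) :: u) =
      Complex.exp ((-θ : ℝ) * Complex.I) * phase k ϑ (l ++ a :: u) := by
    have htw : ϑ ^ twist (l ++ (a + N) :: u) = ϑ ^ twist (l ++ a :: u) := by
      refine zpow_eq_of_modEq hN h0 (twist_modEq l u ?_)
      push_cast
      exact Int.add_modEq_right
    rw [phase, phase, htw, mul_left_comm, ← Complex.exp_add]
    congr 2
    rw [hθdef]
    push_cast
    ring
  rw [hphase, mul_assoc] at g2
  have hfin := sin_sq_mul_normSq_le φ _ (-θ) η g1 g2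
  rw [norm_mul, norm_phase hϑ, one_mul] at hfin
  have hsin : (2 / Real.pi * θ₀) ^ 2 ≤ Real.sin (-θ) ^ 2 := by
    have h0 : Real.sin (-θ) ^ 2 = Real.sin |θ| ^ 2 := by
      rcases abs_choice θ with e | e <;> simp [e]
    rw [h0]
    have h1 : 2 / Real.pi * |θ| ≤ Real.sin |θ| :=
      Real.mul_le_sin (abs_nonneg _) (by linarith [hθ'.2, Real.pi_gt_three])
    have h2 := hθ'.1
    gcongr
    exact le_trans (by gcongr) h1
  have : Q ≤ 5 * η ^ 2 := by
    rw [hQ]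
    exact le_trans (by gcongr) hfin
  linarith

lemma NearLevel.false_of_boundedCondition {N : ℕ} (hN : ϑ ^ N = 1) (h0 : 0 < N)
    (hk : 0 < k.re) (hφ0 : φ ≠ 0) (hx : x ∈ unitIrr) (hnear : NearLevel k ϑ h c φ r K x)
    (hK : 0 ≤ K) (hh : BoundedCondition k ϑ φ h) {C : ℝ}
    (hC : ∀ y : ℝ, y ≠ 0 → |y| ≤ 1 → ‖h y‖ ≤ C) : False := by
  obtain ⟨H, hcont, hH, hcase⟩ := hh
  have hnear' : ∀ η : ℝ, 0 < η → NearLevel k ϑ h c φ r η x := fun η hη =>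
    hnear.mono_of_bounded (norm_eq_one_of_pow hN h0) hk hx hK hC hη
  rcases hcase with ⟨him, p, α, hα, hne⟩ | ⟨him, α, hα, hne⟩
  · exact false_of_bounded_real hN h0 hk hx hnear' hcont hH hα him p hne
  · exact false_of_bounded_complex hN h0 hk hφ0 hx hnear' hcont hH hα him hne

lemma BoundedCondition.exists_bound (hh : BoundedCondition k ϑ φ h) :
    ∃ C : ℝ, ∀ y : ℝ, y ≠ 0 → |y| ≤ 1 → ‖h y‖ ≤ C := by
  obtain ⟨H, hcont, hH, -⟩ := hh
  obtain ⟨C, hC⟩ := isCompact_Icc.exists_bound_of_continuousOn hcont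
  refine ⟨C, fun y hy hy1 => ?_⟩
  rw [← hH y (abs_le.1 hy1) hy]
  exact hC y (abs_le.1 hy1)

end Bounded

lemma growth_of_bound {h : ℝ → ℂ} {C : ℝ} (hC : ∀ y : ℝ, y ≠ 0 → |y| ≤ 1 → ‖h y‖ ≤ C) (δ : ℝ) :
    Growth h C δ := by
  intro y hy hy1
  have hC0 : 0 ≤ C := (norm_nonneg _).trans (hC y hy hy1)
  exact (hC y hy hy1).trans (le_mul_of_one_le_right hC0 (Real.one_le_exp (by positivity)))

lemma tendsto_neg_one_mul_nhdsGT :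
    Tendsto (fun y : ℝ => -1 * y) (𝓝[>] 0) (𝓝[<] 0) := by
  refine tendsto_nhdsWithin_iff.2 ⟨?_, ?_⟩
  · have : Tendsto (fun y : ℝ => -1 * y) (𝓝 0) (𝓝 (-1 * 0)) := tendsto_id.const_mul _
    rw [mul_zero] at this
    exact this.mono_left nhdsWithin_le_nhds
  · filter_upwards [self_mem_nhdsWithin] with y hy
    have : (0 : ℝ) < y := hy
    simpa using this

end QMF

end

theorem theorem7 (k ϑ : ℂ) (hk : 0 < k.re) (hϑ : ∃ N : ℕ, 0 < N ∧ ϑ ^ N = 1)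
    (φ : ℂ →ₗ[ℝ] ℝ) (hφ : φ ≠ 0) (f : ℚ → ℂ) (h : ℝ → ℂ)
    (hf : QMF.IsTwistedQMF k ϑ f h)
    (hh : QMF.BoundedCondition k ϑ φ h ∨
      QMF.UnboundedCondition k ϑ φ h (𝓝[>] 0) ∨ QMF.UnboundedCondition k ϑ φ h (𝓝[<] 0)) :
    (∀ᵐ x ∂(volume.restrict (Set.Icc (0 : ℝ) 1)),
      Tendsto (QMF.daggerApprox k ϑ f x) atTop (𝓝 (QMF.fDagger k ϑ f x))) ∧
    AEMeasurable (QMF.fDagger k ϑ f) (volume.restrict (Set.Icc (0 : ℝ) 1)) ∧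
    Continuous (cdf ((volume.restrict (Set.Icc (0 : ℝ) 1)).map
      (fun x => φ (QMF.fDagger k ϑ f x)))) := by
  obtain ⟨N, hN0, hN⟩ := hϑ
  have hϑ1 := QMF.norm_eq_one_of_pow hN hN0
  obtain ⟨C, δ, hδ, hgrowth⟩ : ∃ C δ : ℝ, δ ∈ Set.Ioo (0 : ℝ) 1 ∧ QMF.Growth h C δ := by
    rcases hh with hb | ⟨-, ⟨δ, hδ, C, hC⟩, -⟩ | ⟨-, ⟨δ, hδ, C, hC⟩, -⟩
    · obtain ⟨C, hC⟩ := hb.exists_bound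
      exact ⟨C, 1 / 2, by norm_num, QMF.growth_of_bound hC _⟩
    · exact ⟨C, δ, hδ, hC⟩
    · exact ⟨C, δ, hδ, hC⟩
  have hmeas := hgrowth.aemeasurable_fDagger hf hδ hk hϑ1
  refine ⟨?_, hmeas, ?_⟩
  · filter_upwards [QMF.ae_mem_goodSet hk hδ] with x hx
    simpa using (hgrowth.tendsto_daggerApprox hf hδ.2 hk hϑ1 QMF.posWord_nil hx.1 hx.2).1
  have hφm : AEMeasurable (fun x => φ (QMF.fDagger k ϑ f x))
      (volume.restrict (Set.Icc (0 : ℝ) 1)) :=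
    φ.continuous_of_finiteDimensional.measurable.comp_aemeasurable hmeas
  have hprob : IsProbabilityMeasure (volume.restrict (Set.Icc (0 : ℝ) 1)) :=
    ⟨by simp⟩
  have := Measure.isProbabilityMeasure_map hφm
  refine QMF.continuous_cdf_of_noAtoms _ fun r => ?_
  -- Only the part of the level set inside the conull `goodSet` matters, where the limit is genuine.
  have hlevel : volume {x | x ∈ QMF.goodSet k δ ∧ φ (QMF.fDagger k ϑ f x) = r} = 0 := by
    by_contra hpos
    obtain ⟨x, hx, K, hK, hnear⟩ := hgrowth.exists_point_of_level_set φ hf hδ hk hϑ1 hpos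
    have hnear : QMF.NearLevel k ϑ h (ϑ * f (-1)) φ r K x := hnear
    rcases hh with hb | hu | hu
    · obtain ⟨C, hC⟩ := hb.exists_bound
      exact hnear.false_of_boundedCondition hN hN0 hk hφ hx hK hb hC
    · exact hnear.false_of_unboundedCondition hN hN0 hk hx hK (σ := 1) (Or.inl rfl)
        (by simp only [one_mul]; exact tendsto_id) hu
    · exact hnear.false_of_unboundedCondition hN hN0 hk hx hK (σ := -1) (Or.inr rfl)
        QMF.tendsto_neg_one_mul_nhdsGT hu
  rw [Measure.map_apply_of_aemeasurable hφm (measurableSet_singleton r)]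
  refine measure_mono_null (t := (QMF.goodSet k δ)ᶜ ∪
    {x | x ∈ QMF.goodSet k δ ∧ φ (QMF.fDagger k ϑ f x) = r}) (fun x hx => ?_)
    (measure_union_null (QMF.ae_mem_goodSet hk hδ)
      (le_antisymm ((Measure.restrict_apply_le _ _).trans hlevel.le) zero_le))
  by_cases hg : x ∈ QMF.goodSet k δ
  · exact Or.inr ⟨hg, hx⟩
  · exact Or.inl hg
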